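/- A knot projection $P$ is (the image of) a generic immersion of the circle into the sphere $S^2$ (finitely many self-intersections, all of them transverse double points) with at least one double point. Its chord diagram is the circle in which, for each double point, the two preimages of that point are joined by a chord. A double point $c$ of $P$ is nugatory if $P$ is the union of two closed parts, neither of them equal to $\{c\}$, that meet in $c$ only; $P$ is reducible if it has a nugatory double point. The non-Seifert splice at a double point $p$ replaces the crossing of the two branches of $P$, in a small disc around $p$, by the two disjoint arcs that do not respect the orientation of $P$: after choosing an orientation of $P$, one arc joins the two incoming ends and the other one joins the two outgoing ends (the result does not depend on the orientation). Let $y(P)$ be the minimum number $n \ge 0$ for which there are $n$ distinct double points of $P$ such that the non-Seifert splices at these $n$ points, all applied simultaneously to $P$, produce a (one-component) reducible knot projection. If $y(P) = 2$, then the chord diagram of $P$ contains the H-shaped three-chord sub-chord diagram: there are three distinct double points of $P$ whose chords $\alpha, \beta, \gamma$ are such that $\alpha$ and $\beta$ do not cross each other and $\gamma$ crosses both $\alpha$ and $\beta$; that is, the endpoints of the three chords occur on the circle in the cyclic order $\alpha\,\gamma\,\alpha\,\beta\,\gamma\,\beta$. -/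

import Mathlib

open scoped ContDiff

/-- The unit sphere `S²` in Euclidean three-space. -/
abbrev S2 : Type := Metric.sphere (0 : EuclideanSpace ℝ (Fin 3)) 1

/-- A knot projection: a generic smooth immersion of the circle `ℝ / ℤ` into `S²` with at least
one double point. Smoothness and derivatives are those of the lift `ℝ → ℝ³`. -/
structure KnotProjection where
  /-- the parametrized curve -/
  toFun : UnitAddCircle → S2
  smooth : ContDiff ℝ ∞ (fun r : ℝ => (toFun (r : UnitAddCircle) : EuclideanSpace ℝ (Fin 3)))
  immersion : ∀ r : ℝ,
    deriv (fun r : ℝ => (toFun (r : UnitAddCircle) : EuclideanSpace ℝ (Fin 3))) r ≠ 0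
  /-- every self-intersection is at most a double one -/
  no_triple : ∀ s t u : UnitAddCircle, toFun s = toFun t → toFun t = toFun u →
    s = t ∨ t = u ∨ s = u
  /-- at a double point the two branches have different tangent lines -/
  transverse : ∀ r r' : ℝ, (r : UnitAddCircle) ≠ (r' : UnitAddCircle) →
    toFun (r : UnitAddCircle) = toFun (r' : UnitAddCircle) →
    LinearIndependent ℝ
      ![deriv (fun r : ℝ => (toFun (r : UnitAddCircle) : EuclideanSpace ℝ (Fin 3))) r,
        deriv (fun r : ℝ => (toFun (r : UnitAddCircle) : EuclideanSpace ℝ (Fin 3))) r']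
  finite_double : {p : S2 | ∃ s t : UnitAddCircle, s ≠ t ∧ toFun s = p ∧ toFun t = p}.Finite
  exists_double : ∃ s t : UnitAddCircle, s ≠ t ∧ toFun s = toFun t

namespace KnotProjection

/-- The curve in `S²` as a set of points. -/
def image (P : KnotProjection) : Set S2 := Set.range P.toFun

/-- `p` is a double point of `P`. -/
def IsDoublePoint (P : KnotProjection) (p : S2) : Prop :=
  ∃ s t : UnitAddCircle, s ≠ t ∧ P.toFun s = p ∧ P.toFun t = p

/-- A nugatory crossing `c`: the curve is made up of two parts `T` and `T'`, neither of them just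
the point `c`, which touch each other nowhere but at the double point `c`. -/
def IsNugatory (P : KnotProjection) (c : S2) : Prop :=
  P.IsDoublePoint c ∧ ∃ T T' : Set S2, IsClosed T ∧ IsClosed T' ∧
    T ∪ T' = P.image ∧ T ∩ T' = {c} ∧ T ≠ {c} ∧ T' ≠ {c}

/-- A reducible knot projection is one that has a nugatory crossing. -/
def Reducible (P : KnotProjection) : Prop := ∃ c : S2, P.IsNugatory c

end KnotProjection

/-- The closed square `[-1, 1]²`, the model of a closed disc. -/
def closedSquare : Set (ℝ × ℝ) := Set.Icc (-1) 1 ×ˢ Set.Icc (-1) 1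

/-- The open square `(-1, 1)²`, the model of an open disc. -/
def openSquare : Set (ℝ × ℝ) := Set.Ioo (-1) 1 ×ˢ Set.Ioo (-1) 1

/-- A closed disc in `S²` around a double point `p` of `P` which `P` meets in just two arcs crossing
at `p`. In the coordinates of the disc these are the horizontal and the vertical axis, each of them
traversed by `P` in the positive direction. -/
structure CrossingDisc (P : KnotProjection) (p : S2) where
  /-- the coordinates -/
  chart : OpenPartialHomeomorph (ℝ × ℝ) S2
  subset_source : closedSquare ⊆ chart.source
  chart_zero : chart (0, 0) = p
  /-- the parameter at which `P` passes through `p` horizontally -/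
  fst : UnitAddCircle
  /-- the parameter at which `P` passes through `p` vertically -/
  snd : UnitAddCircle
  /-- half the length of the two parameter intervals -/
  ε : ℝ
  ε_pos : 0 < ε
  horizontal : ∀ u ∈ Set.Icc (-1 : ℝ) 1, P.toFun (fst + ((ε * u : ℝ) : UnitAddCircle)) = chart (u, 0)
  vertical : ∀ u ∈ Set.Icc (-1 : ℝ) 1, P.toFun (snd + ((ε * u : ℝ) : UnitAddCircle)) = chart (0, u)
  /-- `P` does not enter the disc at other parameters -/
  only : ∀ r : UnitAddCircle, P.toFun r ∈ chart '' closedSquare →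
    (∃ u ∈ Set.Icc (-1 : ℝ) 1, r = fst + ((ε * u : ℝ) : UnitAddCircle)) ∨
    (∃ u ∈ Set.Icc (-1 : ℝ) 1, r = snd + ((ε * u : ℝ) : UnitAddCircle))

namespace CrossingDisc

/-- The closed disc. -/
def carrier {P : KnotProjection} {p : S2} (D : CrossingDisc P p) : Set S2 :=
  D.chart '' closedSquare

/-- The open disc. -/
def inside {P : KnotProjection} {p : S2} (D : CrossingDisc P p) : Set S2 :=
  D.chart '' openSquare

/-- Inside the disc, the crossing of `P` is replaced in `Q` by its non-Seifert smoothing: `Q` meets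
the disc in two disjoint simple arcs, of which one joins the two ends where `P` enters the disc,
`(-1, 0)` and `(0, -1)`, and the other one the two ends where `P` leaves it, `(1, 0)` and
`(0, 1)`. -/
def IsNonSeifertSmoothing {P : KnotProjection} {p : S2} (D : CrossingDisc P p)
    (Q : KnotProjection) : Prop :=
  ∃ (α : Path ((-1, 0) : ℝ × ℝ) (0, -1)) (β : Path ((1, 0) : ℝ × ℝ) (0, 1)),
    Function.Injective α ∧ Function.Injective β ∧
    Disjoint (Set.range α) (Set.range β) ∧
    (∀ u : unitInterval, u ≠ 0 → u ≠ 1 → α u ∈ openSquare ∧ β u ∈ openSquare) ∧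
    Q.image ∩ D.carrier = D.chart '' (Set.range α ∪ Set.range β)

end CrossingDisc

namespace KnotProjection

/-- `Q` is obtained from `P` by non-Seifert splices at all points of `S` simultaneously: there are
disjoint discs around these double points of `P` such that, up to a change of parameter, `Q` agrees
with `P` outside the open discs, and in each disc the crossing is replaced by its non-Seifert
smoothing (for the given orientation of `P`). -/
def IsNonSeifertSplice (P Q : KnotProjection) (S : Finset S2) : Prop :=
  ∃ D : (p : S) → CrossingDisc P p,
    (∀ p q : S, p ≠ q → Disjoint (D p).carrier (D q).carrier) ∧
    (∃ h : {r : UnitAddCircle // P.toFun r ∉ ⋃ p : S, (D p).inside} ≃ₜ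
        {r : UnitAddCircle // Q.toFun r ∉ ⋃ p : S, (D p).inside},
      ∀ r, Q.toFun (h r) = P.toFun r) ∧
    ∀ p : S, (D p).IsNonSeifertSmoothing Q

/-- The reductivity `y(P)`: the minimum number of non-Seifert splices, applied simultaneously, that
turn `P` into a reducible knot projection (`⊤` if there is no such number). -/
noncomputable def y (P : KnotProjection) : ℕ∞ :=
  sInf {n : ℕ∞ | ∃ (S : Finset S2) (Q : KnotProjection),
    P.IsNonSeifertSplice Q S ∧ Q.Reducible ∧ n = (S.card : ℕ∞)}

end KnotProjection

/-- A chord diagram on a circle (or on another circularly ordered set) `C`: finitely many chords,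
i.e. unordered pairs of different points, without common endpoints. -/
structure ChordDiagram (C : Type*) where
  /-- the chords, each given by its two endpoints -/
  chords : Set (Sym2 C)
  finite : chords.Finite
  not_isDiag : ∀ e ∈ chords, ¬ e.IsDiag
  eq_of_mem : ∀ e ∈ chords, ∀ e' ∈ chords, ∀ x : C, x ∈ e → x ∈ e' → e = e'

namespace ChordDiagram

/-- `x` is an endpoint of a chord. -/
def IsEndpoint {C : Type*} (D : ChordDiagram C) (x : C) : Prop := ∃ e ∈ D.chords, x ∈ e

/-- `D` has a sub-chord diagram of the form `E`: the endpoints of `E` can be placed among those of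
`D` in the same cyclic order and such that chords become chords. -/
def HasSubdiagram {C C' : Type*} [CircularOrder C] [CircularOrder C']
    (D : ChordDiagram C) (E : ChordDiagram C') : Prop :=
  ∃ f : C' → C,
    (∀ x y z : C', E.IsEndpoint x → E.IsEndpoint y → E.IsEndpoint z →
      sbtw x y z → sbtw (f x) (f y) (f z)) ∧
    ∀ e ∈ E.chords, Sym2.map f e ∈ D.chords

/-- The chord diagram shaped like the letter H, on six points `0, …, 5` in cyclic order: two chords
`{0, 2}` and `{3, 5}` that do not cross each other, and a chord `{1, 4}` that crosses both. -/
def H : ChordDiagram (Fin 6) where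
  chords := {s(0, 2), s(3, 5), s(1, 4)}
  finite := by simp
  not_isDiag := by
    intro e he
    simp only [Set.mem_insert_iff, Set.mem_singleton_iff] at he
    rcases he with rfl | rfl | rfl <;> decide
  eq_of_mem := by
    intro e he e' he'
    simp only [Set.mem_insert_iff, Set.mem_singleton_iff] at he he'
    rcases he with rfl | rfl | rfl <;> rcases he' with rfl | rfl | rfl <;> decide

end ChordDiagram

/-- The chord diagram of a knot projection: the two preimages of each double point are joined by a
chord. -/
def KnotProjection.chordDiagram (P : KnotProjection) : ChordDiagram UnitAddCircle where
  chords := {e | ∃ s t : UnitAddCircle, s ≠ t ∧ P.toFun s = P.toFun t ∧ e = s(s, t)}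
  finite := by
    have key : {x : UnitAddCircle | P.IsDoublePoint (P.toFun x)}.Finite := by
      have : {x : UnitAddCircle | P.IsDoublePoint (P.toFun x)} =
          ⋃ p ∈ {p : S2 | ∃ s t : UnitAddCircle, s ≠ t ∧ P.toFun s = p ∧ P.toFun t = p},
            {x | P.toFun x = p} := by
        ext x
        simp only [KnotProjection.IsDoublePoint, Set.mem_ofPred_eq, Set.mem_iUnion, exists_prop]
        exact ⟨fun h => ⟨_, h, rfl⟩, fun ⟨p, h, hp⟩ => hp ▸ h⟩
      rw [this]
      refine P.finite_double.biUnion ?_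
      rintro p ⟨s, t, hst, hs, ht⟩
      refine (Set.toFinite {s, t}).subset ?_
      intro x hx
      have hx' : P.toFun x = p := hx
      rcases P.no_triple s t x (hs.trans ht.symm) (ht.trans hx'.symm) with h | h | h
      · exact absurd h hst
      · exact Or.inr h.symm
      · exact Or.inl h.symm
    refine ((key.prod key).image (fun q => s(q.1, q.2))).subset ?_
    rintro e ⟨s, t, hst, h, rfl⟩
    exact ⟨(s, t), ⟨⟨s, t, hst, rfl, h.symm⟩, ⟨s, t, hst, h, rfl⟩⟩, rfl⟩
  not_isDiag := by
    rintro e ⟨s, t, hst, -, rfl⟩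
    simpa using hst
  eq_of_mem := by
    have key : ∀ s t u v x : UnitAddCircle, s ≠ t → P.toFun s = P.toFun t → u ≠ v →
        P.toFun u = P.toFun v → x ∈ s(s, t) → x ∈ s(u, v) → s(s, t) = s(u, v) := by
      intro s t u v x hst h huv h' hx hx'
      have e1 : P.toFun x = P.toFun s := by
        rcases Sym2.mem_iff.1 hx with rfl | rfl
        · rfl
        · exact h.symm
      have e2 : P.toFun x = P.toFun u := by
        rcases Sym2.mem_iff.1 hx' with rfl | rfl
        · rfl
        · exact h'.symm
      have a := P.no_triple s t u h (h.symm.trans (e1.symm.trans e2))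
      have b := P.no_triple s t v h (h.symm.trans (e1.symm.trans (e2.trans h')))
      rw [Sym2.eq_iff]
      grind
    rintro e ⟨s, t, hst, h, rfl⟩ e' ⟨u, v, huv, h', rfl⟩ x hx hx'
    exact key s t u v x hst h huv h' hx hx'

/-! A double point whose chord is crossed by no other chord is nugatory, since the two arcs between
its preimages then meet only there (`reducible_of_uncrossed`). If `y P = 2`, neither `P` nor a knot
projection obtained from it by one splice is reducible. Hence every chord of `P` is crossed by
another one, and the same holds after one splice.

Let `χ` be the chord of a double point `c`, and let the chord `δ` cross `χ`. The non-Seifert splice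
`Q` at `c` runs through one of the two arcs cut off by `χ` as before and through the other one
backwards. So the chords of `Q` are the chords of `P` other than `χ`. A chord that does not cross
`χ` crosses `δ` in `Q` iff it does so in `P`; for a chord that crosses `χ`, the reversal exchanges
crossing and not crossing `δ`. Now some chord `η` crosses `δ` in `Q`. In `P` it crosses exactly one
of `χ` and `δ`. As these two cross each other, the one that `η` crosses is the bar of an H whose
uprights are `η` and the other one (`exists_splice_reducible_or_H`).

Most of the work is to build `Q` as a smooth generic immersion (`SmoothCrossing.splice`). The
inverse function theorem gives smooth coordinates in which the branches at `c` are the axes; in a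
small square the crossing is replaced by a smooth corner and its negative, which coincide with the
axes near the boundary. No double points arise in the square, and outside it `Q` is `P`
reparametrized. -/

/-! ### Cyclic order and real representatives on the circle -/

theorem UnitAddCircle.sbtw_coe {a b c : ℝ} (hab : a < b) (hbc : b < c) (hca : c < a + 1) :
    sbtw (a : UnitAddCircle) b c := by
  refine sbtw_iff_btw_not_btw.2 ⟨?_, ?_⟩
  · refine QuotientAddGroup.btw_coe_iff.2 ?_
    rw [(toIcoMod_eq_self _).2 ⟨hab.le, by linarith⟩, (toIocMod_eq_self _).2 ⟨by linarith, hca.le⟩]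
    exact hbc.le
  · intro h
    have h := QuotientAddGroup.btw_coe_iff.1 h
    rw [← toIcoMod_add_right _ c b, ← toIocMod_add_right _ c a,
      (toIcoMod_eq_self _).2 ⟨by linarith, by linarith⟩,
      (toIocMod_eq_self _).2 ⟨by linarith, by linarith⟩] at h
    linarith

theorem UnitAddCircle.coe_ne_coe {a b : ℝ} (hab : a < b) (hba : b < a + 1) :
    (a : UnitAddCircle) ≠ b := fun h =>
  hab.ne ((AddCircle.coe_eq_coe_iff_of_mem_Ico (p := (1 : ℝ)) (a := a) ⟨le_rfl, by linarith⟩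
    ⟨hab.le, hba⟩).1 h)

theorem UnitAddCircle.exists_coe_eq (a : ℝ) (x : UnitAddCircle) :
    ∃ r : ℝ, a ≤ r ∧ r < a + 1 ∧ (r : UnitAddCircle) = x :=
  ⟨AddCircle.equivIco 1 a x, (AddCircle.equivIco 1 a x).2.1, (AddCircle.equivIco 1 a x).2.2,
    AddCircle.coe_equivIco⟩

theorem UnitAddCircle.coe_add_one (a : ℝ) : ((a + 1 : ℝ) : UnitAddCircle) = a :=
  AddCircle.coe_add_period 1 a

/-! ### H-shaped subdiagrams and uncrossed chords -/

namespace KnotProjection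

/-- Six parameters in cyclic order, paired in the pattern `α γ α β γ β`, give an H. -/
theorem hasSubdiagram_H (P : KnotProjection) {r : Fin 6 → ℝ} (hr : StrictMono r)
    (h5 : r 5 < r 0 + 1) (h02 : P.toFun (r 0) = P.toFun (r 2))
    (h35 : P.toFun (r 3) = P.toFun (r 5)) (h14 : P.toFun (r 1) = P.toFun (r 4)) :
    P.chordDiagram.HasSubdiagram ChordDiagram.H := by
  have lt (i j : Fin 6) : r i < r j + 1 := by
    have h1 := hr.monotone (Fin.le_last i)
    have h2 := hr.monotone (Fin.zero_le j)
    have : r (Fin.last 5) = r 5 := rfl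
    linarith
  have ne (i j : Fin 6) (h : i < j) : (r i : UnitAddCircle) ≠ r j :=
    UnitAddCircle.coe_ne_coe (hr h) (lt _ _)
  refine ⟨fun i => (r i : UnitAddCircle), ?_, ?_⟩
  · intro x y z _ _ _ h
    have key {i j k : Fin 6} (hij : i < j) (hjk : j < k) :
        sbtw (r i : UnitAddCircle) (r j) (r k) :=
      UnitAddCircle.sbtw_coe (hr hij) (hr hjk) (lt _ _)
    rcases Fin.sbtw_iff.1 h with ⟨h1, h2⟩ | ⟨h1, h2⟩ | ⟨h1, h2⟩
    · exact key h1 h2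
    · exact (key h1 h2).cyclic_right
    · exact (key h1 h2).cyclic_left
  · intro e he
    simp only [ChordDiagram.H, Set.mem_insert_iff, Set.mem_singleton_iff] at he
    rcases he with rfl | rfl | rfl
    · exact ⟨_, _, ne 0 2 (by decide), h02, rfl⟩
    · exact ⟨_, _, ne 3 5 (by decide), h35, rfl⟩
    · exact ⟨_, _, ne 1 4 (by decide), h14, rfl⟩

theorem hasSubdiagram_H' (P : KnotProjection) {a b c d e f : ℝ} (hab : a < b) (hbc : b < c)
    (hcd : c < d) (hde : d < e) (hef : e < f) (hfa : f < a + 1) (hac : P.toFun a = P.toFun c)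
    (hbe : P.toFun b = P.toFun e) (hdf : P.toFun d = P.toFun f) :
    P.chordDiagram.HasSubdiagram ChordDiagram.H := by
  refine P.hasSubdiagram_H (r := ![a, b, c, d, e, f]) ?_ hfa hac hdf hbe
  refine Fin.strictMono_iff_lt_succ.2 fun i => ?_
  fin_cases i <;> assumption

theorem continuous_coe (P : KnotProjection) : Continuous fun r : ℝ => P.toFun r :=
  Topology.IsInducing.subtypeVal.continuous_iff.2 P.smooth.continuous

/-- A double point whose chord is crossed by no other chord is nugatory. -/
theorem reducible_of_uncrossed (Q : KnotProjection) {x y : ℝ} (hxy : x < y) (hyx : y < x + 1)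
    (h : Q.toFun x = Q.toFun y)
    (hne : ∀ u ∈ Set.Ioo x y, ∀ v ∈ Set.Ioo y (x + 1), Q.toFun u ≠ Q.toFun v) : Q.Reducible := by
  have hx1 : Q.toFun ((x + 1 : ℝ) : UnitAddCircle) = Q.toFun x := by
    rw [UnitAddCircle.coe_add_one]
  -- Neither part is a single point: otherwise the midpoint of its parameter interval would be a
  -- third preimage of the double point.
  have mid : ∀ a b : ℝ, a < b → b < a + 1 → Q.toFun a = Q.toFun b →
      (fun r : ℝ => Q.toFun r) '' Set.Icc a b ≠ {Q.toFun a} := by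
    intro a b hab hba hQ heq
    have hm : Q.toFun ((a + b) / 2 : ℝ) = Q.toFun a := by
      have : Q.toFun ((a + b) / 2 : ℝ) ∈ (fun r : ℝ => Q.toFun r) '' Set.Icc a b :=
        ⟨_, ⟨by linarith, by linarith⟩, rfl⟩
      rwa [heq] at this
    rcases Q.no_triple a ((a + b) / 2 : ℝ) b hm.symm (hm.trans hQ) with h | h | h
    · exact UnitAddCircle.coe_ne_coe (by linarith) (by linarith) h
    · exact UnitAddCircle.coe_ne_coe (by linarith) (by linarith) h
    · exact UnitAddCircle.coe_ne_coe hab hba h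
  refine ⟨Q.toFun x, ⟨x, y, UnitAddCircle.coe_ne_coe hxy hyx, rfl, h.symm⟩,
    (fun r : ℝ => Q.toFun r) '' Set.Icc x y, (fun r : ℝ => Q.toFun r) '' Set.Icc y (x + 1),
    (isCompact_Icc.image Q.continuous_coe).isClosed,
    (isCompact_Icc.image Q.continuous_coe).isClosed, ?_, ?_, mid x y hxy hyx h, ?_⟩
  · rw [← Set.image_union, Set.Icc_union_Icc_eq_Icc hxy.le hyx.le]
    ext p
    constructor
    · rintro ⟨r, -, rfl⟩
      exact ⟨_, rfl⟩
    · rintro ⟨z, rfl⟩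
      obtain ⟨r, h1, h2, rfl⟩ := UnitAddCircle.exists_coe_eq x z
      exact ⟨r, ⟨h1, h2.le⟩, rfl⟩
  · ext p
    constructor
    · rintro ⟨⟨u, ⟨hu1, hu2⟩, rfl⟩, ⟨v, ⟨hv1, hv2⟩, huv⟩⟩
      simp only at huv
      rw [Set.mem_singleton_iff]
      rcases hu1.eq_or_lt with rfl | hu1
      · rfl
      rcases hu2.eq_or_lt with rfl | hu2
      · exact h.symm
      rcases hv1.eq_or_lt with rfl | hv1
      · exact huv.symm.trans h.symm
      rcases hv2.eq_or_lt with rfl | hv2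
      · exact huv.symm.trans hx1
      exact absurd huv.symm (hne u ⟨hu1, hu2⟩ v ⟨hv1, hv2⟩)
    · rintro rfl
      exact ⟨⟨x, ⟨le_rfl, hxy.le⟩, rfl⟩, ⟨y, ⟨le_rfl, hyx.le⟩, h.symm⟩⟩
  · rw [h]
    exact mid y (x + 1) hyx (by linarith) (h.symm.trans hx1.symm)

/-- No splices change nothing. -/
theorem isNonSeifertSplice_empty (P : KnotProjection) : P.IsNonSeifertSplice P ∅ :=
  ⟨fun p => absurd p.2 (Finset.notMem_empty _), fun p => absurd p.2 (Finset.notMem_empty _),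
    ⟨Homeomorph.refl _, fun _ => rfl⟩, fun p => absurd p.2 (Finset.notMem_empty _)⟩

end KnotProjection

/-! ### Smooth coordinates at a transverse crossing -/

open Topology in
/-- Two smooth curves on the sphere which cross transversally are the axes of smooth local
coordinates; the coordinate functions extend differentiably to the ambient space. -/
theorem exists_smooth_chart_of_transverse {a b : ℝ → S2}
    (ha : ContDiff ℝ ∞ fun x => (a x : EuclideanSpace ℝ (Fin 3)))
    (hb : ContDiff ℝ ∞ fun x => (b x : EuclideanSpace ℝ (Fin 3))) (hab : a 0 = b 0)
    (hli : LinearIndependent ℝ ![deriv (fun x => (a x : EuclideanSpace ℝ (Fin 3))) 0,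
      deriv (fun x => (b x : EuclideanSpace ℝ (Fin 3))) 0]) :
    ∃ (φ : OpenPartialHomeomorph (ℝ × ℝ) S2) (ψ : EuclideanSpace ℝ (Fin 3) → ℝ × ℝ),
      (0, 0) ∈ φ.source ∧ φ (0, 0) = a 0 ∧ (∀ᶠ x in 𝓝 (0 : ℝ), φ (x, 0) = a x) ∧
      (∀ᶠ y in 𝓝 (0 : ℝ), φ (0, y) = b y) ∧
      (∀ z ∈ φ.source, ContDiffAt ℝ ∞ (fun w => (φ w : EuclideanSpace ℝ (Fin 3))) z) ∧
      ∀ z ∈ φ.source, DifferentiableAt ℝ ψ (φ z) ∧ ψ (φ z) = z := by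
  -- Stereographic projection from the antipode of the crossing sends the crossing to `0`.
  set v : EuclideanSpace ℝ (Fin 3) := ((-a 0 : S2) : EuclideanSpace ℝ (Fin 3)) with hvdef
  have hv : ‖v‖ = 1 := norm_eq_of_mem_sphere (-a 0)
  set σ := stereographic hv
  have hσ0 : stereoToFun v (a 0) = 0 := stereographic_neg_apply (a 0)
  have hopen : IsOpen {x : EuclideanSpace ℝ (Fin 3) | innerSL ℝ v x ≠ 1} :=
    isOpen_ne_fun (innerSL ℝ v).continuous continuous_const
  have ha0 : innerSL ℝ v (a 0 : EuclideanSpace ℝ (Fin 3)) ≠ 1 := by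
    have : ‖(a 0 : EuclideanSpace ℝ (Fin 3))‖ = 1 := norm_eq_of_mem_sphere (a 0)
    simp [hvdef, this]
    norm_num
  have smooth {x : EuclideanSpace ℝ (Fin 3)} (hx : innerSL ℝ v x ≠ 1) :
      ContDiffAt ℝ ∞ (stereoToFun v) x :=
    (contDiffOn_stereoToFun (v := v)).contDiffAt (hopen.mem_nhds hx)
  set A : ℝ → (ℝ ∙ v)ᗮ := fun x => stereoToFun v (a x) with hA
  set B : ℝ → (ℝ ∙ v)ᗮ := fun x => stereoToFun v (b x) with hB
  have inv_smooth : ContDiff ℝ ∞ fun w : (ℝ ∙ v)ᗮ => (stereoInvFun hv w : EuclideanSpace ℝ (Fin 3)) :=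
    (contDiff_stereoInvFunAux (v := v)).comp (ℝ ∙ v)ᗮ.subtypeL.contDiff
  have left_inv {x : S2} (hx : innerSL ℝ v (x : EuclideanSpace ℝ (Fin 3)) ≠ 1) :
      stereoInvFun hv (stereoToFun v x) = x :=
    stereo_left_inv hv fun h => hx (by simp [h, hv])
  have hAs : ∀ x, innerSL ℝ v (a x : EuclideanSpace ℝ (Fin 3)) ≠ 1 → ContDiffAt ℝ ∞ A x :=
    fun x hx => ContDiffAt.comp (g := stereoToFun v) x (smooth hx) ha.contDiffAt
  have hBs : ∀ x, innerSL ℝ v (b x : EuclideanSpace ℝ (Fin 3)) ≠ 1 → ContDiffAt ℝ ∞ B x :=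
    fun x hx => ContDiffAt.comp (g := stereoToFun v) x (smooth hx) hb.contDiffAt
  have hb0 : innerSL ℝ v (b 0 : EuclideanSpace ℝ (Fin 3)) ≠ 1 := hab ▸ ha0
  have hA0 : A 0 = 0 := hσ0
  have hB0 : B 0 = 0 := by rw [hB]; simp only [← hab]; exact hσ0
  have hWa : IsOpen {x : ℝ | innerSL ℝ v (a x : EuclideanSpace ℝ (Fin 3)) ≠ 1} :=
    hopen.preimage ha.continuous
  have hWb : IsOpen {x : ℝ | innerSL ℝ v (b x : EuclideanSpace ℝ (Fin 3)) ≠ 1} :=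
    hopen.preimage hb.continuous
  have hAd : HasDerivAt A (deriv A 0) 0 := ((hAs 0 ha0).differentiableAt (by simp)).hasDerivAt
  have hBd : HasDerivAt B (deriv B 0) 0 := ((hBs 0 hb0).differentiableAt (by simp)).hasDerivAt
  -- The derivative of the inverse projection maps the planar velocities to the given independent
  -- ones, so the planar ones are independent too.
  have hli' : LinearIndependent ℝ ![deriv A 0, deriv B 0] := by
    set L := fderiv ℝ (fun w : (ℝ ∙ v)ᗮ => (stereoInvFun hv w : EuclideanSpace ℝ (Fin 3))) 0
    have hL : HasFDerivAt (fun w : (ℝ ∙ v)ᗮ => (stereoInvFun hv w : EuclideanSpace ℝ (Fin 3))) L 0 :=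
      (inv_smooth.differentiable (by simp) 0).hasFDerivAt
    have h1 : deriv (fun x => (a x : EuclideanSpace ℝ (Fin 3))) 0 = L (deriv A 0) := by
      have h := HasFDerivAt.comp_hasDerivAt (0 : ℝ) (by rw [hA0]; exact hL) hAd
      refine (h.congr_of_eventuallyEq ?_).deriv
      filter_upwards [hWa.mem_nhds ha0] with x hx
      simp only [Function.comp, hA, left_inv hx]
    have h2 : deriv (fun x => (b x : EuclideanSpace ℝ (Fin 3))) 0 = L (deriv B 0) := by
      have h := HasFDerivAt.comp_hasDerivAt (0 : ℝ) (by rw [hB0]; exact hL) hBd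
      refine (h.congr_of_eventuallyEq ?_).deriv
      filter_upwards [hWb.mem_nhds hb0] with x hx
      simp only [Function.comp, hB, left_inv hx]
    refine LinearIndependent.of_comp L.toLinearMap ?_
    convert hli using 1
    ext i : 1
    fin_cases i <;> simp [h1, h2]
  -- As `A 0 = B 0 = 0`, this map restricts to `A` and `B` on the axes; its derivative at the origin
  -- is invertible, so the inverse function theorem applies.
  set G : ℝ × ℝ → (ℝ ∙ v)ᗮ := fun z => A z.1 + B z.2 with hG
  have hGs : ∀ z : ℝ × ℝ, innerSL ℝ v (a z.1 : EuclideanSpace ℝ (Fin 3)) ≠ 1 →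
      innerSL ℝ v (b z.2 : EuclideanSpace ℝ (Fin 3)) ≠ 1 → ContDiffAt ℝ ∞ G z :=
    fun z h1 h2 => ((hAs _ h1).comp z contDiffAt_fst).add ((hBs _ h2).comp z contDiffAt_snd)
  set T : ℝ × ℝ →L[ℝ] (ℝ ∙ v)ᗮ :=
    (ContinuousLinearMap.fst ℝ ℝ ℝ).smulRight (deriv A 0) +
      (ContinuousLinearMap.snd ℝ ℝ ℝ).smulRight (deriv B 0) with hT
  have hGT : HasFDerivAt G T (0, 0) := by
    have h1 : HasFDerivAt (fun z : ℝ × ℝ => A z.1) _ (0, 0) :=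
      HasFDerivAt.comp (g := A) ((0, 0) : ℝ × ℝ) hAd.hasFDerivAt hasFDerivAt_fst
    have h2 : HasFDerivAt (fun z : ℝ × ℝ => B z.2) _ (0, 0) :=
      HasFDerivAt.comp (g := B) ((0, 0) : ℝ × ℝ) hBd.hasFDerivAt hasFDerivAt_snd
    refine HasFDerivAt.congr_fderiv (h1.add h2) ?_
    ext <;> simp [hT]
  have hTinj : Function.Injective T.toLinearMap := by
    rw [← LinearMap.ker_eq_bot, LinearMap.ker_eq_bot']
    rintro ⟨x, y⟩ hxy
    obtain ⟨hx, hy⟩ := LinearIndependent.pair_iff.1 hli' x y (by simpa [hT] using hxy)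
    rw [hx, hy]; rfl
  have hdim : Module.finrank ℝ (ℝ × ℝ) = Module.finrank ℝ (ℝ ∙ v)ᗮ := by
    have : Fact (Module.finrank ℝ (EuclideanSpace ℝ (Fin 3)) = 2 + 1) := ⟨by simp⟩
    rw [Submodule.finrank_orthogonal_span_singleton (n := 2) (norm_ne_zero_iff.1 (by simp [hv]))]
    simp
  set T' : (ℝ × ℝ) ≃L[ℝ] (ℝ ∙ v)ᗮ :=
    (LinearEquiv.ofInjectiveOfFinrankEq T.toLinearMap hTinj hdim).toContinuousLinearEquiv
  have hGT' : HasFDerivAt G (T' : ℝ × ℝ →L[ℝ] (ℝ ∙ v)ᗮ) (0, 0) := by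
    convert hGT using 1
    ext <;> rfl
  have hG0 : ContDiffAt ℝ ∞ G (0, 0) := hGs _ ha0 hb0
  set e := hG0.toOpenPartialHomeomorph G hGT' (by simp)
  have he0 : (0, 0) ∈ e.source := hG0.mem_toOpenPartialHomeomorph_source hGT' (by simp)
  -- Smoothness of order `∞` at a point need not hold on one common neighbourhood for all orders,
  -- whereas order 1 does spread to a neighbourhood; differentiability is all that is asked of `ψ`.
  have hsymm : ∀ᶠ w in 𝓝 (G (0, 0)), ContDiffAt ℝ 1 e.symm w := by
    refine ContDiffAt.eventually ?_ (by simp)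
    exact (hG0.to_localInverse hGT' (by simp)).of_le (by simp)
  have hsymm' : ∀ᶠ z in 𝓝 ((0, 0) : ℝ × ℝ), ContDiffAt ℝ 1 e.symm (G z) :=
    hG0.continuousAt.eventually hsymm
  have hWa' : ∀ᶠ z : ℝ × ℝ in 𝓝 (0, 0), innerSL ℝ v (a z.1 : EuclideanSpace ℝ (Fin 3)) ≠ 1 :=
    (hWa.preimage continuous_fst).mem_nhds (x := ((0, 0) : ℝ × ℝ)) ha0
  have hWb' : ∀ᶠ z : ℝ × ℝ in 𝓝 (0, 0), innerSL ℝ v (b z.2 : EuclideanSpace ℝ (Fin 3)) ≠ 1 :=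
    (hWb.preimage continuous_snd).mem_nhds (x := ((0, 0) : ℝ × ℝ)) hb0
  obtain ⟨W, hW, hWo, hW0⟩ := eventually_nhds_iff.1 (hsymm'.and (hWa'.and hWb'))
  have hcoe : ∀ z, (e.restr W).trans σ.symm z = stereoInvFun hv (G z) := fun z => rfl
  have hsrc : ∀ z ∈ ((e.restr W).trans σ.symm).source, z ∈ e.source ∧ z ∈ W := by
    intro z hz
    have : z ∈ (e.restr W).source := hz.1
    rwa [e.restr_source' W hWo] at this
  refine ⟨(e.restr W).trans σ.symm, e.symm ∘ stereoToFun v, ?_, ?_, ?_, ?_, ?_, ?_⟩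
  · refine ⟨?_, Set.mem_univ _⟩
    change (0, 0) ∈ (e.restr W).source
    rw [e.restr_source' W hWo]
    exact ⟨he0, hW0⟩
  · rw [hcoe]
    simp only [hG, hB0, add_zero, hA]
    exact left_inv ha0
  · filter_upwards [hWa.mem_nhds ha0] with x hx
    rw [hcoe]
    simp only [hG, hB0, add_zero, hA]
    exact left_inv hx
  · filter_upwards [hWb.mem_nhds hb0] with x hx
    rw [hcoe]
    simp only [hG, hA0, zero_add, hB]
    exact left_inv hx
  · intro z hz
    obtain ⟨-, h1, h2⟩ := hW z (hsrc z hz).2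
    exact inv_smooth.contDiffAt.comp z (hGs z h1 h2)
  · intro z hz
    obtain ⟨h0, -⟩ := hW z (hsrc z hz).2
    have h3 : stereoToFun v (stereoInvFun hv (G z)) = G z := stereo_right_inv hv _
    have h4 : innerSL ℝ v (stereoInvFun hv (G z) : EuclideanSpace ℝ (Fin 3)) ≠ 1 := by
      intro h
      exact stereoInvFun_ne_north_pole hv (G z) (Subtype.ext
        ((inner_eq_one_iff_of_norm_eq_one (𝕜 := ℝ) hv (norm_eq_of_mem_sphere _)).1 h).symm)
    rw [hcoe]
    refine ⟨DifferentiableAt.comp _ ?_ ((smooth h4).differentiableAt (by simp)), ?_⟩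
    · rw [h3]
      exact h0.differentiableAt (by simp)
    · rw [Function.comp, h3]
      exact e.left_inv (hsrc z hz).1

/-! ### Smooth models for the corner -/

/-- A smooth even positive function which agrees with the absolute value away from zero. -/
theorem exists_smooth_abs : ∃ h : ℝ → ℝ, ContDiff ℝ ∞ h ∧ (∀ u, h (-u) = h u) ∧ (∀ u, |u| ≤ h u) ∧
    (∀ u, 0 < h u) ∧ (∀ u, 1 / 2 ≤ |u| → h u = |u|) ∧ ∀ u, |u| ≤ 1 / 2 → h u < 3 / 2 := by
  let b : ContDiffBump (0 : ℝ) := ⟨1 / 4, 1 / 2, by norm_num, by norm_num⟩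
  have hpos : ∀ u : ℝ, 0 < u ^ 2 + b u := by
    intro u
    rcases eq_or_ne u 0 with rfl | hu
    · rw [b.one_of_mem_closedBall (by simp [b])]
      norm_num
    · have := b.nonneg (x := u)
      positivity
  -- The bump is 1 at the origin, which keeps the radicand positive, and vanishes for `1 / 2 ≤ |u|`.
  -- The bound `3 / 2` is what makes `(u + h u) / 2 < 1` for `u ≤ 1 / 2`.
  refine ⟨fun u => √(u ^ 2 + b u), ?_, ?_, ?_, ?_, ?_, ?_⟩
  · exact ((contDiff_id.pow 2).add b.contDiff).sqrt fun u => (hpos u).ne'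
  · intro u
    simp only [b.neg, neg_sq]
  · intro u
    refine Real.abs_le_sqrt ?_
    linarith [b.nonneg (x := u)]
  · exact fun u => Real.sqrt_pos.2 (hpos u)
  · intro u hu
    simp only
    rw [b.zero_of_le_dist (by simpa only [b, Real.dist_eq, sub_zero] using hu), add_zero, Real.sqrt_sq_eq_abs]
  · intro u hu
    rw [Real.sqrt_lt' (by norm_num)]
    have h1 : u ^ 2 ≤ (1 / 2) ^ 2 := sq_le_sq' (by linarith [abs_le.1 hu]) (abs_le.1 hu).2
    linarith [b.le_one (x := u)]

/-- A smooth nonnegative version of the positive part whose odd part is linear. -/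
theorem exists_smooth_posPart : ∃ φ : ℝ → ℝ, ContDiff ℝ ∞ φ ∧ (∀ u, φ u - φ (-u) = u) ∧
    (∀ u, 0 ≤ φ u) ∧ (∀ u, 0 < φ u + φ (-u)) ∧ (∀ u, 1 / 2 ≤ u → φ u = u) ∧
    (∀ u, u ≤ -(1 / 2) → φ u = 0) ∧ ∀ u, |u| < 1 → φ u < 1 := by
  obtain ⟨h, hs, he, hle, hpos, heq, hlt⟩ := exists_smooth_abs
  -- This is the formula `max u 0 = (u + |u|) / 2` with the absolute value smoothed.
  refine ⟨fun u => (u + h u) / 2, (contDiff_id.add hs).div_const 2, ?_, ?_, ?_, ?_, ?_, ?_⟩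
  · intro u
    simp only [he]
    ring
  · intro u
    have := neg_abs_le u
    linarith [hle u]
  · intro u
    simp only [he]
    linarith [hpos u]
  · intro u hu
    have h1 : |u| = u := abs_of_nonneg (by linarith)
    simp only
    rw [heq u (by rwa [h1]), h1]
    ring
  · intro u hu
    have h1 : |u| = -u := abs_of_nonpos (by linarith)
    simp only
    rw [heq u (by rw [h1]; linarith), h1]
    ring
  · intro u hu
    have h1 := le_abs_self u
    rcases le_total |u| (1 / 2) with h2 | h2
    · linarith [hlt u h2]
    · simp only
      rw [heq u h2]
      linarith

/-! ### Crossing discs with smooth coordinates -/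

/-- A disc around the double point `P (m - ℓ) = P (m + ℓ)` with smooth coordinates. -/
structure SmoothCrossing (P : KnotProjection) (m ℓ : ℝ) extends
    CrossingDisc P (P.toFun ((m - ℓ : ℝ) : UnitAddCircle)) where
  fst_eq : fst = ((m - ℓ : ℝ) : UnitAddCircle)
  snd_eq : snd = ((m + ℓ : ℝ) : UnitAddCircle)
  ε_lt : ε < ℓ
  add_ε_lt : ℓ + ε < 1 / 2
  smooth : ∀ z ∈ chart.source, ContDiffAt ℝ ∞ (fun w => (chart w : EuclideanSpace ℝ (Fin 3))) z
  /-- a differentiable extension of the coordinates to the ambient space -/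
  coord : EuclideanSpace ℝ (Fin 3) → ℝ × ℝ
  differentiableAt_coord : ∀ z ∈ chart.source, DifferentiableAt ℝ coord (chart z)
  coord_chart : ∀ z ∈ chart.source, coord (chart z) = z

-- Rescaling the coordinates by a small `ε` suffices. Parameters away from the two preimages of the
-- crossing form a compact set whose image misses the crossing, hence also a small square. Near the
-- preimages the curve is an axis, and injectivity of the chart locates the parameter.
open Topology in
theorem KnotProjection.nonempty_smoothCrossing (P : KnotProjection) {m ℓ : ℝ} (hℓ0 : 0 < ℓ)
    (hℓ1 : ℓ < 1 / 2)
    (h : P.toFun ((m - ℓ : ℝ) : UnitAddCircle) = P.toFun ((m + ℓ : ℝ) : UnitAddCircle)) :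
    Nonempty (SmoothCrossing P m ℓ) := by
  have hne : ((m - ℓ : ℝ) : UnitAddCircle) ≠ ((m + ℓ : ℝ) : UnitAddCircle) :=
    UnitAddCircle.coe_ne_coe (by linarith) (by linarith)
  obtain ⟨φ, ψ, h0, hφ0, ha, hb, hs, hψ⟩ := exists_smooth_chart_of_transverse
    (a := fun x => P.toFun ((m - ℓ + x : ℝ) : UnitAddCircle))
    (b := fun x => P.toFun ((m + ℓ + x : ℝ) : UnitAddCircle))
    (P.smooth.comp (contDiff_const.add contDiff_id)) (P.smooth.comp (contDiff_const.add contDiff_id))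
    (by simpa using h) (by
      rw [deriv_comp_const_add (f := fun r : ℝ => (P.toFun r : EuclideanSpace ℝ (Fin 3))),
        deriv_comp_const_add (f := fun r : ℝ => (P.toFun r : EuclideanSpace ℝ (Fin 3)))]
      simpa using P.transverse (m - ℓ) (m + ℓ) hne h)
  simp only [add_zero] at hφ0
  obtain ⟨δ, hδ, hδa⟩ := Metric.eventually_nhds_iff.1
    (((ha.and hb).and ((Continuous.tendsto' (by fun_prop) (0 : ℝ) ((0, 0) : ℝ × ℝ) rfl :
      Filter.Tendsto (fun x : ℝ => (x, (0 : ℝ))) _ _).eventually (φ.open_source.mem_nhds h0))).and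
      ((Continuous.tendsto' (by fun_prop) (0 : ℝ) ((0, 0) : ℝ × ℝ) rfl :
      Filter.Tendsto (fun x : ℝ => ((0 : ℝ), x)) _ _).eventually (φ.open_source.mem_nhds h0)))
  simp only [Real.dist_eq, sub_zero] at hδa
  -- One period, from `m - ℓ` to `m - ℓ + 1`, without the `δ`-neighbourhoods of the crossing
  -- parameters; both of its ends represent the same preimage.
  set K : Set ℝ := Set.Icc (m - ℓ) (m - ℓ + 1) ∩ ({r | δ ≤ |r - (m - ℓ)|} ∩
    ({r | δ ≤ |r - (m + ℓ)|} ∩ {r | δ ≤ |r - (m - ℓ + 1)|}))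
  have hKc : IsCompact K := isCompact_Icc.inter_right
    ((isClosed_le (by fun_prop) (by fun_prop)).inter
      ((isClosed_le (by fun_prop) (by fun_prop)).inter (isClosed_le (by fun_prop) (by fun_prop))))
  have hPK : IsClosed ((fun r : ℝ => P.toFun r) '' K) := (hKc.image P.continuous_coe).isClosed
  have hcK : φ (0, 0) ∉ (fun r : ℝ => P.toFun r) '' K := by
    rw [hφ0]
    rintro ⟨r, ⟨⟨hr1, hr2⟩, hr3, hr4, hr5⟩, hr⟩
    simp only at hr
    simp only [Set.mem_ofPred_eq] at hr3 hr4 hr5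
    have e1 : r ≠ m - ℓ := by rintro rfl; simp at hr3; linarith
    have e2 : r ≠ m + ℓ := by rintro rfl; simp at hr4; linarith
    have e3 : r ≠ m - ℓ + 1 := by rintro rfl; simp at hr5; linarith
    have l1 := lt_of_le_of_ne hr1 e1.symm
    have l3 := lt_of_le_of_ne hr2 e3
    rcases P.no_triple _ _ _ hr h with h' | h' | h'
    · exact UnitAddCircle.coe_ne_coe l1 l3 h'.symm
    · exact hne h'
    · rcases e2.lt_or_gt with l2 | l2
      · exact UnitAddCircle.coe_ne_coe l2 (by linarith) h'
      · exact UnitAddCircle.coe_ne_coe l2 (by linarith) h'.symm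
  have hn : ∀ᶠ z in 𝓝 ((0, 0) : ℝ × ℝ), z ∈ φ.source ∧ φ z ∉ (fun r : ℝ => P.toFun r) '' K :=
    Filter.Eventually.and (φ.open_source.mem_nhds h0)
      ((φ.continuousAt h0).eventually (hPK.isOpen_compl.mem_nhds hcK))
  obtain ⟨δ', hδ', hsq⟩ := Metric.eventually_nhds_iff.1 hn
  obtain ⟨ε, hε, hεlt⟩ : ∃ ε : ℝ, 0 < ε ∧ ε < min (min δ δ') (min ℓ (1 / 2 - ℓ)) :=
    exists_between (lt_min (lt_min hδ hδ') (lt_min hℓ0 (by linarith)))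
  obtain ⟨⟨hεδ, hεδ'⟩, hεℓ, hεℓ'⟩ : (ε < δ ∧ ε < δ') ∧ ε < ℓ ∧ ε < 1 / 2 - ℓ := by
    simpa only [lt_min_iff] using hεlt
  have hsmul : ∀ z ∈ closedSquare, ε • z ∈ φ.source ∧ φ (ε • z) ∉ (fun r : ℝ => P.toFun r) '' K := by
    rintro ⟨x, y⟩ ⟨⟨hx1, hx2⟩, hy1, hy2⟩
    apply hsq
    simp only at hx1 hx2 hy1 hy2
    have hx : |ε * x| ≤ ε := by
      rw [abs_mul, abs_of_pos hε]
      exact mul_le_of_le_one_right hε.le (abs_le.2 ⟨hx1, hx2⟩)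
    have hy : |ε * y| ≤ ε := by
      rw [abs_mul, abs_of_pos hε]
      exact mul_le_of_le_one_right hε.le (abs_le.2 ⟨hy1, hy2⟩)
    simp only [Prod.dist_eq, Real.dist_eq, Prod.smul_mk, smul_eq_mul, sub_zero]
    exact max_lt (hx.trans_lt hεδ') (hy.trans_lt hεδ')
  have hεu : ∀ u ∈ Set.Icc (-1 : ℝ) 1, |ε * u| < δ := by
    intro u hu
    rw [abs_mul, abs_of_pos hε]
    exact (mul_le_of_le_one_right hε.le (abs_le.2 hu)).trans_lt hεδ
  have hℓε : ℓ + ε < 1 / 2 := by linarith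
  have hsm : ContDiff ℝ ∞ fun w : ℝ × ℝ => ε • w := contDiff_const_smul ε
  refine ⟨⟨⟨(Homeomorph.smulOfNeZero ε hε.ne').transOpenPartialHomeomorph φ,
    fun z hz => (hsmul z hz).1, ?_, ((m - ℓ : ℝ) : UnitAddCircle), ((m + ℓ : ℝ) : UnitAddCircle), ε, hε,
    ?_, ?_, ?_⟩, rfl, rfl, hεℓ, hℓε, ?_, fun w => ε⁻¹ • ψ w, ?_, ?_⟩⟩
  · simpa using hφ0
  · intro u hu
    have := (hδa (hεu u hu)).1.1.1
    simpa [AddCircle.coe_add] using this.symm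
  · intro u hu
    have := (hδa (hεu u hu)).1.1.2
    simpa [AddCircle.coe_add] using this.symm
  · rintro r ⟨z, hz, hzr⟩
    replace hzr : φ (ε • z) = P.toFun r := hzr
    obtain ⟨hz1, hz2⟩ := hsmul z hz
    obtain ⟨t, ht1, ht2, rfl⟩ := UnitAddCircle.exists_coe_eq (m - ℓ) r
    have key1 : ∀ x : ℝ, |x| < δ → P.toFun ((m - ℓ + x : ℝ) : UnitAddCircle) = φ (ε • z) →
        ∃ u ∈ Set.Icc (-1 : ℝ) 1, ε * u = x := by
      intro x hx hxz
      have hd := hδa hx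
      have : (x, (0 : ℝ)) = ε • z := φ.injOn hd.1.2 hz1 (hd.1.1.1.trans hxz)
      exact ⟨z.1, hz.1, (congrArg Prod.fst this).symm⟩
    have key2 : ∀ x : ℝ, |x| < δ → P.toFun ((m + ℓ + x : ℝ) : UnitAddCircle) = φ (ε • z) →
        ∃ u ∈ Set.Icc (-1 : ℝ) 1, ε * u = x := by
      intro x hx hxz
      have hd := hδa hx
      have : ((0 : ℝ), x) = ε • z := φ.injOn hd.2 hz1 (hd.1.1.2.trans hxz)
      exact ⟨z.2, hz.2, (congrArg Prod.snd this).symm⟩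
    by_cases c1 : |t - (m - ℓ)| < δ
    · obtain ⟨u, hu, hux⟩ := key1 _ c1 (by rw [add_sub_cancel]; exact hzr.symm)
      refine Or.inl ⟨u, hu, ?_⟩
      rw [hux, ← AddCircle.coe_add, add_sub_cancel]
    by_cases c2 : |t - (m + ℓ)| < δ
    · obtain ⟨u, hu, hux⟩ := key2 _ c2 (by rw [add_sub_cancel]; exact hzr.symm)
      refine Or.inr ⟨u, hu, ?_⟩
      rw [hux, ← AddCircle.coe_add, add_sub_cancel]
    by_cases c3 : |t - (m - ℓ + 1)| < δ
    · have e : ((m - ℓ + (t - (m - ℓ + 1)) : ℝ) : UnitAddCircle) = t := by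
        rw [← UnitAddCircle.coe_add_one]
        congr 1
        ring
      obtain ⟨u, hu, hux⟩ := key1 _ c3 (by rw [e]; exact hzr.symm)
      refine Or.inl ⟨u, hu, ?_⟩
      rw [hux, ← AddCircle.coe_add, e]
    exact absurd ⟨t, ⟨⟨ht1, ht2.le⟩, not_lt.1 c1, not_lt.1 c2, not_lt.1 c3⟩, hzr.symm⟩ hz2
  · intro z hz
    exact ContDiffAt.comp (g := fun w => (φ w : EuclideanSpace ℝ (Fin 3))) z (hs (ε • z) hz) hsm.contDiffAt
  · intro z hz
    exact ((hψ (ε • z) hz).1).const_smul ε⁻¹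
  · intro z hz
    change ε⁻¹ • ψ (φ (ε • z)) = z
    rw [(hψ (ε • z) hz).2, inv_smul_smul₀ hε.ne']

/-! ### Distance from zero on the circle, corners, and reversal of an arc -/

theorem UnitAddCircle.norm_coe_of_abs_le {r : ℝ} (h : |r| ≤ 1 / 2) : ‖(r : UnitAddCircle)‖ = |r| :=
  (AddCircle.norm_coe_eq_abs_iff (p := 1) (by norm_num)).2 (by simpa using h)

theorem UnitAddCircle.le_norm_coe {r ℓ : ℝ} (h0 : 0 ≤ ℓ) (h1 : ℓ ≤ r) (h2 : r ≤ 1 - ℓ) :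
    ℓ ≤ ‖(r : UnitAddCircle)‖ := by
  rcases le_total r (1 / 2) with h | h
  · rw [norm_coe_of_abs_le (abs_le.2 ⟨by linarith, h⟩)]
    exact h1.trans (le_abs_self r)
  · rw [← sub_add_cancel r 1, coe_add_one, norm_coe_of_abs_le (abs_le.2 ⟨by linarith, by linarith⟩)]
    exact le_trans (by linarith) (neg_le_abs (r - 1))

theorem UnitAddCircle.exists_coe_eq_abs_eq_norm (x : UnitAddCircle) :
    ∃ r : ℝ, (r : UnitAddCircle) = x ∧ |r| = ‖x‖ := by
  obtain ⟨r, h1, h2, rfl⟩ := exists_coe_eq (-(1 / 2)) x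
  exact ⟨r, rfl, (norm_coe_of_abs_le (abs_le.2 ⟨h1, by linarith⟩)).symm⟩

/-- The shape of a smoothed crossing, running from the positive vertical axis to the positive
horizontal axis. -/
noncomputable def corner (u : ℝ) : ℝ × ℝ :=
  (exists_smooth_posPart.choose u, exists_smooth_posPart.choose (-u))

theorem contDiff_corner : ContDiff ℝ ∞ corner :=
  exists_smooth_posPart.choose_spec.1.prodMk (exists_smooth_posPart.choose_spec.1.comp contDiff_neg)

/-- The parameter can be read off as the difference of the coordinates. This yields both the
injectivity of the corner and its nonvanishing velocity. -/
theorem corner_fst_sub_snd (u : ℝ) : (corner u).1 - (corner u).2 = u :=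
  exists_smooth_posPart.choose_spec.2.1 u

theorem corner_fst_add_snd_pos (u : ℝ) : 0 < (corner u).1 + (corner u).2 :=
  exists_smooth_posPart.choose_spec.2.2.2.1 u

theorem corner_of_le {u : ℝ} (hu : 1 / 2 ≤ u) : corner u = (u, 0) :=
  Prod.ext (exists_smooth_posPart.choose_spec.2.2.2.2.1 u hu)
    (exists_smooth_posPart.choose_spec.2.2.2.2.2.1 (-u) (neg_le_neg hu))

theorem corner_of_le_neg {u : ℝ} (hu : u ≤ -(1 / 2)) : corner u = (0, -u) :=
  Prod.ext (exists_smooth_posPart.choose_spec.2.2.2.2.2.1 u hu)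
    (exists_smooth_posPart.choose_spec.2.2.2.2.1 (-u) (le_neg_of_le_neg hu))

theorem corner_mem_openSquare {u : ℝ} (hu : |u| < 1) : corner u ∈ openSquare := by
  obtain ⟨-, -, h0, -, -, -, h1⟩ := exists_smooth_posPart.choose_spec
  exact ⟨⟨by linarith [h0 u, show (corner u).1 = exists_smooth_posPart.choose u from rfl],
    h1 u hu⟩, ⟨by linarith [h0 (-u), show (corner u).2 = exists_smooth_posPart.choose (-u) from rfl],
    h1 (-u) (by rwa [abs_neg])⟩⟩

theorem corner_injective : Function.Injective corner := fun u v h => by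
  rw [← corner_fst_sub_snd u, h, corner_fst_sub_snd]

/-- The line on which the coordinates sum to zero separates the corner from its negative. -/
theorem corner_ne_neg_corner (u v : ℝ) : corner u ≠ -corner v := fun h => by
  have h1 := corner_fst_add_snd_pos u
  have h2 := corner_fst_add_snd_pos v
  rw [h, Prod.fst_neg, Prod.snd_neg] at h1
  linarith

theorem neg_mem_openSquare {z : ℝ × ℝ} (hz : z ∈ openSquare) : -z ∈ openSquare := by
  obtain ⟨⟨h1, h2⟩, h3, h4⟩ := hz
  exact ⟨⟨neg_lt_neg h2, neg_lt.1 h1⟩, ⟨neg_lt_neg h4, neg_lt.1 h3⟩⟩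

theorem openSquare_subset_closedSquare : openSquare ⊆ closedSquare :=
  Set.prod_mono Set.Ioo_subset_Icc_self Set.Ioo_subset_Icc_self

/-- Reversal of the arc of those points of the circle whose distance from zero exceeds `ℓ`. -/
noncomputable def reverseArc (ℓ : ℝ) (x : UnitAddCircle) : UnitAddCircle :=
  if ‖x‖ ≤ ℓ then x else -x

theorem reverseArc_of_le {ℓ : ℝ} {x : UnitAddCircle} (h : ‖x‖ ≤ ℓ) : reverseArc ℓ x = x := if_pos h

theorem reverseArc_of_lt {ℓ : ℝ} {x : UnitAddCircle} (h : ℓ < ‖x‖) : reverseArc ℓ x = -x :=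
  if_neg h.not_ge

theorem norm_reverseArc (ℓ : ℝ) (x : UnitAddCircle) : ‖reverseArc ℓ x‖ = ‖x‖ := by
  unfold reverseArc
  split_ifs <;> simp

theorem reverseArc_reverseArc (ℓ : ℝ) (x : UnitAddCircle) :
    reverseArc ℓ (reverseArc ℓ x) = x := by
  rcases le_or_gt ‖x‖ ℓ with h | h
  · rw [reverseArc_of_le h, reverseArc_of_le h]
  · rw [reverseArc_of_lt h, reverseArc_of_lt (by rwa [norm_neg]), neg_neg]

theorem reverseArc_injective (ℓ : ℝ) : Function.Injective (reverseArc ℓ) :=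
  Function.LeftInverse.injective (reverseArc_reverseArc ℓ)

/-- The reversal jumps only at the two preimages `±ℓ` of the crossing, which lie inside the disc. -/
theorem continuousAt_reverseArc {ℓ : ℝ} {x : UnitAddCircle} (h : ‖x‖ ≠ ℓ) :
    ContinuousAt (reverseArc ℓ) x := by
  rcases h.lt_or_gt with h | h
  · refine continuousAt_id.congr ?_
    filter_upwards [continuous_norm.continuousAt.eventually_lt_const h] with y hy
    exact (reverseArc_of_le hy.le).symm
  · refine continuous_neg.continuousAt.congr ?_
    filter_upwards [continuous_norm.continuousAt.eventually_const_lt h] with y hy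
    exact (reverseArc_of_lt hy).symm

/-! ### Parameters of `P` in the disc, measured from the midpoint `m` -/

namespace SmoothCrossing

variable {P : KnotProjection} {m ℓ : ℝ} (X : SmoothCrossing P m ℓ)

theorem chart_horizontal {u : ℝ} (hu : |u| ≤ 1) :
    X.chart (u, 0) = P.toFun ((m + (-ℓ + X.ε * u) : ℝ) : UnitAddCircle) := by
  rw [← X.horizontal u (abs_le.1 hu), X.fst_eq, ← AddCircle.coe_add]
  ring_nf

theorem chart_vertical {u : ℝ} (hu : |u| ≤ 1) :
    X.chart (0, u) = P.toFun ((m + (ℓ + X.ε * u) : ℝ) : UnitAddCircle) := by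
  rw [← X.vertical u (abs_le.1 hu), X.snd_eq, ← AddCircle.coe_add]
  ring_nf

theorem abs_mul_ε_le {u : ℝ} (hu : |u| ≤ 1) : |X.ε * u| ≤ X.ε := by
  rw [abs_mul, abs_of_pos X.ε_pos]
  exact mul_le_of_le_one_right X.ε_pos.le hu

/-- The bounds `ε < ℓ` and `ℓ + ε < 1 / 2` keep the parameter interval between `0` and `1 / 2`, the
points where the distance from zero folds. -/
theorem norm_coe_add {u : ℝ} (hu : |u| ≤ 1) :
    ‖((ℓ + X.ε * u : ℝ) : UnitAddCircle)‖ = ℓ + X.ε * u := by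
  have h1 := abs_le.1 (X.abs_mul_ε_le hu)
  have h2 := X.ε_lt
  have h3 := X.add_ε_lt
  have h4 : 0 ≤ ℓ + X.ε * u := by linarith
  rw [UnitAddCircle.norm_coe_of_abs_le (by rw [abs_of_nonneg h4]; linarith), abs_of_nonneg h4]

theorem norm_coe_neg_add {u : ℝ} (hu : |u| ≤ 1) :
    ‖((-ℓ + X.ε * u : ℝ) : UnitAddCircle)‖ = ℓ - X.ε * u := by
  have h : -(-ℓ + X.ε * u) = ℓ + X.ε * -u := by ring
  rw [← norm_neg, ← AddCircle.coe_neg, h, X.norm_coe_add (by rwa [abs_neg])]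
  ring

theorem exists_coe_eq {x : UnitAddCircle} (hx : |‖x‖ - ℓ| ≤ X.ε) :
    ∃ u : ℝ, X.ε * |u| = |‖x‖ - ℓ| ∧ |u| ≤ 1 ∧
      (x = ((ℓ + X.ε * u : ℝ) : UnitAddCircle) ∨ x = ((-ℓ + X.ε * u : ℝ) : UnitAddCircle)) := by
  obtain ⟨r, rfl, hr⟩ := UnitAddCircle.exists_coe_eq_abs_eq_norm x
  have hε := X.ε_pos
  have key : ∀ v : ℝ, |v| = |‖(r : UnitAddCircle)‖ - ℓ| →
      X.ε * |v / X.ε| = |‖(r : UnitAddCircle)‖ - ℓ| ∧ |v / X.ε| ≤ 1 ∧ X.ε * (v / X.ε) = v := by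
    intro v hv
    rw [abs_div, abs_of_pos hε, div_le_one hε, hv, mul_div_cancel₀ _ hε.ne', mul_div_cancel₀ _ hε.ne']
    exact ⟨rfl, hx, rfl⟩
  rcases le_total 0 r with h | h
  · rw [abs_of_nonneg h] at hr
    obtain ⟨h1, h2, h3⟩ := key (r - ℓ) (by rw [← hr])
    refine ⟨(r - ℓ) / X.ε, h1, h2, Or.inl ?_⟩
    rw [h3, add_sub_cancel]
  · rw [abs_of_nonpos h] at hr
    obtain ⟨h1, h2, h3⟩ := key (r + ℓ) (by rw [← hr, ← abs_neg]; ring_nf)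
    refine ⟨(r + ℓ) / X.ε, h1, h2, Or.inr ?_⟩
    rw [h3]
    ring_nf

theorem abs_lt_one {u t : ℝ} (h : X.ε * |u| = t) (ht : t < X.ε) : |u| < 1 := by
  by_contra! h1
  have := mul_le_mul_of_nonneg_left h1 X.ε_pos.le
  linarith

theorem mem_source {z : ℝ × ℝ} (hz : z ∈ openSquare) : z ∈ X.chart.source :=
  X.subset_source (openSquare_subset_closedSquare hz)

theorem mem_source_horizontal {u : ℝ} (hu : |u| ≤ 1) : (u, 0) ∈ X.chart.source :=
  X.subset_source ⟨abs_le.1 hu, by simp⟩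

theorem mem_source_vertical {u : ℝ} (hu : |u| ≤ 1) : (0, u) ∈ X.chart.source :=
  X.subset_source ⟨by simp, abs_le.1 hu⟩

theorem coe_add_left_injective {x : UnitAddCircle} {r : ℝ}
    (h : (m : UnitAddCircle) + x = ((m + r : ℝ) : UnitAddCircle)) : x = r := by
  rwa [AddCircle.coe_add, add_right_inj] at h

theorem exists_of_mem_carrier {x : UnitAddCircle} (h : P.toFun (m + x) ∈ X.carrier) :
    ∃ u : ℝ, |u| ≤ 1 ∧ (x = ((-ℓ + X.ε * u : ℝ) : UnitAddCircle) ∨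
      x = ((ℓ + X.ε * u : ℝ) : UnitAddCircle)) := by
  rcases X.only _ h with ⟨u, hu, hx⟩ | ⟨u, hu, hx⟩
  · refine ⟨u, abs_le.2 hu, Or.inl (coe_add_left_injective (m := m) ?_)⟩
    rw [hx, X.fst_eq, ← AddCircle.coe_add]
    ring_nf
  · refine ⟨u, abs_le.2 hu, Or.inr (coe_add_left_injective (m := m) ?_)⟩
    rw [hx, X.snd_eq, ← AddCircle.coe_add]
    ring_nf

theorem abs_norm_sub_le_of_mem_carrier {x : UnitAddCircle} (h : P.toFun (m + x) ∈ X.carrier) :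
    |‖x‖ - ℓ| ≤ X.ε := by
  obtain ⟨u, hu, rfl | rfl⟩ := X.exists_of_mem_carrier h
  · rw [X.norm_coe_neg_add hu, sub_right_comm, sub_self, zero_sub, abs_neg]
    exact X.abs_mul_ε_le hu
  · rw [X.norm_coe_add hu, add_sub_cancel_left]
    exact X.abs_mul_ε_le hu

theorem inside_subset_carrier : X.inside ⊆ X.carrier :=
  Set.image_mono openSquare_subset_closedSquare

theorem chart_mem_inside_iff {z : ℝ × ℝ} (hz : z ∈ X.chart.source) :
    X.chart z ∈ X.inside ↔ z ∈ openSquare := by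
  refine ⟨?_, fun h => ⟨z, h, rfl⟩⟩
  rintro ⟨w, hw, hwz⟩
  rwa [← X.chart.injOn (X.mem_source hw) hz hwz]

/-- The criterion involves only `‖x‖`, which the reversal preserves; this is why the splice enters
the open disc at the same parameters. -/
theorem mem_inside_iff {x : UnitAddCircle} :
    P.toFun (m + x) ∈ X.inside ↔ |‖x‖ - ℓ| < X.ε := by
  have hε := X.ε_pos
  have key : ∀ u : ℝ, |u| ≤ 1 → (|X.ε * u| < X.ε ↔ |u| < 1) := by
    intro u hu
    rw [abs_mul, abs_of_pos hε]
    exact mul_lt_iff_lt_one_right hε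
  have main : ∀ u : ℝ, |u| ≤ 1 → (x = ((-ℓ + X.ε * u : ℝ) : UnitAddCircle) ∨
      x = ((ℓ + X.ε * u : ℝ) : UnitAddCircle)) →
      (P.toFun (m + x) ∈ X.inside ↔ |‖x‖ - ℓ| < X.ε) := by
    rintro u hu (rfl | rfl)
    · rw [X.norm_coe_neg_add hu, sub_right_comm, sub_self, zero_sub, abs_neg, key u hu,
        ← AddCircle.coe_add, ← X.chart_horizontal hu,
        X.chart_mem_inside_iff (X.mem_source_horizontal hu)]
      simp [openSquare, abs_lt]
    · rw [X.norm_coe_add hu, add_sub_cancel_left, key u hu,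
        ← AddCircle.coe_add, ← X.chart_vertical hu,
        X.chart_mem_inside_iff (X.mem_source_vertical hu)]
      simp [openSquare, abs_lt]
  constructor
  · intro h
    obtain ⟨u, hu, hx⟩ := X.exists_of_mem_carrier (X.inside_subset_carrier h)
    exact (main u hu hx).1 h
  · intro h
    obtain ⟨u, -, hu, hx⟩ := X.exists_coe_eq h.le
    exact (main u hu hx.symm).2 h

/-- Inside the disc, the curve has no double point but the centre. -/
theorem norm_eq_of_toFun_eq {x y : UnitAddCircle} (hxy : x ≠ y)
    (h : P.toFun (m + x) = P.toFun (m + y)) (hx : |‖x‖ - ℓ| < X.ε) : ‖x‖ = ℓ := by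
  have hin := X.mem_inside_iff.2 hx
  obtain ⟨u, hu, hxu⟩ := X.exists_of_mem_carrier (X.inside_subset_carrier hin)
  obtain ⟨v, hv, hyv⟩ := X.exists_of_mem_carrier (X.inside_subset_carrier (h ▸ hin))
  rcases hxu with rfl | rfl <;> rcases hyv with rfl | rfl <;>
    simp only [← AddCircle.coe_add, ← X.chart_horizontal hu, ← X.chart_vertical hu,
      ← X.chart_horizontal hv, ← X.chart_vertical hv] at h
  · have := X.chart.injOn (X.mem_source_horizontal hu) (X.mem_source_horizontal hv) h
    simp only [Prod.mk.injEq, and_true] at this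
    exact absurd (this ▸ rfl) hxy
  · have := X.chart.injOn (X.mem_source_horizontal hu) (X.mem_source_vertical hv) h
    simp only [Prod.mk.injEq] at this
    rw [X.norm_coe_neg_add hu, this.1]
    ring
  · have := X.chart.injOn (X.mem_source_vertical hu) (X.mem_source_horizontal hv) h
    simp only [Prod.mk.injEq] at this
    rw [X.norm_coe_add hu, this.2]
    ring
  · have := X.chart.injOn (X.mem_source_vertical hu) (X.mem_source_vertical hv) h
    simp only [Prod.mk.injEq, true_and] at this
    exact absurd (this ▸ rfl) hxy

end SmoothCrossing

/-- Translation by `r' - r` leaves the lift unchanged, so regularity may be checked at a convenient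
representative. -/
theorem UnitAddCircle.contDiffAt_and_deriv_ne_zero_congr {E : Type*} [NormedAddCommGroup E]
    [NormedSpace ℝ E] {F : UnitAddCircle → E} {r r' : ℝ}
    (h : (r : UnitAddCircle) = r')
    (hF : ContDiffAt ℝ ∞ (fun t : ℝ => F t) r' ∧ deriv (fun t : ℝ => F t) r' ≠ 0) :
    ContDiffAt ℝ ∞ (fun t : ℝ => F t) r ∧ deriv (fun t : ℝ => F t) r ≠ 0 := by
  have e : (fun t : ℝ => F t) = fun t : ℝ => (fun t : ℝ => F t) (t + (r' - r)) := by
    ext t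
    simp only [AddCircle.coe_add, AddCircle.coe_sub, h, sub_self, add_zero]
  have e' : r + (r' - r) = r' := by ring
  constructor
  · rw [e]
    refine ContDiffAt.comp (g := fun t : ℝ => F t) r ?_ (contDiffAt_id.add contDiffAt_const)
    simpa only [id, e'] using hF.1
  · rw [e, deriv_comp_add_const (f := fun t : ℝ => F t), e']
    exact hF.2

/-! ### The splice as a knot projection -/

namespace SmoothCrossing

variable {P : KnotProjection} {m ℓ : ℝ} (X : SmoothCrossing P m ℓ)

/-- The parametrization of the non-Seifert splice: outside the disc, the arc of `P` that does not
contain `P m` is traversed backwards, and inside the disc the curve runs through two corners. -/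
noncomputable def spliceMap (x : UnitAddCircle) : S2 :=
  if |‖x‖ - ℓ| < X.ε then
    -- The representative in `[-1/2, 1/2)` is positive near `ℓ` and negative near `-ℓ`. The branch
    -- at `ℓ` joins the incoming ends, the one at `-ℓ` the outgoing ends.
    if 0 < (AddCircle.equivIco 1 (-(1 / 2)) x : ℝ) then
      X.chart (-corner (((AddCircle.equivIco 1 (-(1 / 2)) x : ℝ) - ℓ) / X.ε))
    else X.chart (corner (((AddCircle.equivIco 1 (-(1 / 2)) x : ℝ) + ℓ) / X.ε))
  else P.toFun (m + reverseArc ℓ x)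

theorem spliceMap_of_le_abs {x : UnitAddCircle} (hx : X.ε ≤ |‖x‖ - ℓ|) :
    X.spliceMap x = P.toFun (m + reverseArc ℓ x) := if_neg hx.not_gt

theorem equivIco_coe {r : ℝ} (h : |r| < 1 / 2) :
    (AddCircle.equivIco (1 : ℝ) (-(1 / 2)) (r : UnitAddCircle) : ℝ) = r := by
  rw [abs_lt] at h
  rw [AddCircle.equivIco_coe_eq (p := (1 : ℝ)) (a := -(1 / 2)) ⟨h.1.le, by linarith⟩]

theorem eq_one_or_eq_neg_one {u : ℝ} (hu : |u| ≤ 1) (hu' : ¬|u| < 1) : u = 1 ∨ u = -1 :=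
  eq_or_eq_neg_of_abs_eq (le_antisymm hu (not_lt.1 hu'))

theorem spliceMap_coe_add {u : ℝ} (hu : |u| ≤ 1) :
    X.spliceMap ((ℓ + X.ε * u : ℝ) : UnitAddCircle) = X.chart (-corner u) := by
  have hε := X.ε_pos
  have h1 := abs_le.1 (X.abs_mul_ε_le hu)
  have h2 := X.ε_lt
  have h3 := X.add_ε_lt
  have hn : |‖((ℓ + X.ε * u : ℝ) : UnitAddCircle)‖ - ℓ| = X.ε * |u| := by
    rw [X.norm_coe_add hu, add_sub_cancel_left, abs_mul, abs_of_pos hε]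
  by_cases hu1 : |u| < 1
  · rw [spliceMap, hn, if_pos (mul_lt_of_lt_one_right hε hu1),
      equivIco_coe (abs_lt.2 ⟨by linarith, by linarith⟩), if_pos (by linarith), add_sub_cancel_left,
      mul_div_cancel_left₀ _ hε.ne']
  · rw [X.spliceMap_of_le_abs (by rw [hn]; exact le_mul_of_one_le_right hε.le (not_lt.1 hu1))]
    rcases eq_one_or_eq_neg_one hu hu1 with rfl | rfl
    · rw [reverseArc_of_lt (by rw [X.norm_coe_add hu]; linarith), corner_of_le (by norm_num),
        Prod.neg_mk, neg_zero, X.chart_horizontal (by simp), ← AddCircle.coe_neg, ← AddCircle.coe_add]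
      congr 2
      ring
    · rw [reverseArc_of_le (by rw [X.norm_coe_add hu]; linarith), corner_of_le_neg (by norm_num),
        Prod.neg_mk, neg_zero, neg_neg, X.chart_vertical (by simp), ← AddCircle.coe_add]

theorem spliceMap_coe_neg_add {u : ℝ} (hu : |u| ≤ 1) :
    X.spliceMap ((-ℓ + X.ε * u : ℝ) : UnitAddCircle) = X.chart (corner u) := by
  have hε := X.ε_pos
  have h1 := abs_le.1 (X.abs_mul_ε_le hu)
  have h2 := X.ε_lt
  have h3 := X.add_ε_lt
  have hn : |‖((-ℓ + X.ε * u : ℝ) : UnitAddCircle)‖ - ℓ| = X.ε * |u| := by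
    rw [X.norm_coe_neg_add hu, sub_right_comm, sub_self, zero_sub, abs_neg, abs_mul, abs_of_pos hε]
  by_cases hu1 : |u| < 1
  · rw [spliceMap, hn, if_pos (mul_lt_of_lt_one_right hε hu1),
      equivIco_coe (abs_lt.2 ⟨by linarith, by linarith⟩), if_neg (by linarith),
      neg_add_cancel_comm, mul_div_cancel_left₀ _ hε.ne']
  · rw [X.spliceMap_of_le_abs (by rw [hn]; exact le_mul_of_one_le_right hε.le (not_lt.1 hu1))]
    rcases eq_one_or_eq_neg_one hu hu1 with rfl | rfl
    · rw [reverseArc_of_le (by rw [X.norm_coe_neg_add hu]; linarith), corner_of_le (by norm_num),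
        X.chart_horizontal (by simp), ← AddCircle.coe_add]
    · rw [reverseArc_of_lt (by rw [X.norm_coe_neg_add hu]; linarith), corner_of_le_neg (by norm_num),
        X.chart_vertical (by simp), ← AddCircle.coe_neg, ← AddCircle.coe_add]
      congr 2
      ring

/-- The corner lies on an axis once `1 / 2 ≤ |u|`, so the formula outside the disc persists for `ε /
2` into it. With this overlap nothing has to be glued at the boundary. -/
theorem spliceMap_of_norm_le {x : UnitAddCircle} (hx : ‖x‖ ≤ ℓ - X.ε / 2) :
    X.spliceMap x = P.toFun (m + x) := by
  have hε := X.ε_pos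
  by_cases h : |‖x‖ - ℓ| < X.ε
  · obtain ⟨u, -, hu, rfl | rfl⟩ := X.exists_coe_eq h.le
    · rw [X.norm_coe_add hu] at hx
      have : u ≤ -(1 / 2) := le_of_mul_le_mul_left (by linarith) hε
      rw [X.spliceMap_coe_add hu, corner_of_le_neg this, Prod.neg_mk, neg_zero, neg_neg,
        X.chart_vertical hu, ← AddCircle.coe_add]
    · rw [X.norm_coe_neg_add hu] at hx
      have : 1 / 2 ≤ u := le_of_mul_le_mul_left (by linarith) hε
      rw [X.spliceMap_coe_neg_add hu, corner_of_le this, X.chart_horizontal hu, ← AddCircle.coe_add]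
  · rw [X.spliceMap_of_le_abs (not_lt.1 h), reverseArc_of_le (by linarith)]

theorem spliceMap_of_le_norm {x : UnitAddCircle} (hx : ℓ + X.ε / 2 ≤ ‖x‖) :
    X.spliceMap x = P.toFun (m - x) := by
  have hε := X.ε_pos
  by_cases h : |‖x‖ - ℓ| < X.ε
  · obtain ⟨u, -, hu, rfl | rfl⟩ := X.exists_coe_eq h.le
    · rw [X.norm_coe_add hu] at hx
      have : 1 / 2 ≤ u := le_of_mul_le_mul_left (by linarith) hε
      rw [X.spliceMap_coe_add hu, corner_of_le this, Prod.neg_mk, neg_zero,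
        X.chart_horizontal (by rwa [abs_neg]), ← AddCircle.coe_sub]
      congr 2
      ring
    · rw [X.norm_coe_neg_add hu] at hx
      have : u ≤ -(1 / 2) := le_of_mul_le_mul_left (by linarith) hε
      rw [X.spliceMap_coe_neg_add hu, corner_of_le_neg this, X.chart_vertical (by rwa [abs_neg]),
        ← AddCircle.coe_sub]
      congr 2
      ring
  · rw [X.spliceMap_of_le_abs (not_lt.1 h), reverseArc_of_lt (by linarith), sub_eq_add_neg]

/-- The coordinates recover `γ` differentiably from its image in space. A vanishing velocity there
would make that of `γ` vanish, against the slope `k` of the coordinate difference. -/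
theorem regular_chart_comp {γ : ℝ → ℝ × ℝ} {r k d : ℝ} (hγ : ContDiffAt ℝ ∞ γ r)
    (hr : γ r ∈ X.chart.source) (hk : k ≠ 0) (hd : ∀ t, (γ t).1 - (γ t).2 = k * t + d) :
    ContDiffAt ℝ ∞ (fun t => (X.chart (γ t) : EuclideanSpace ℝ (Fin 3))) r ∧
      deriv (fun t => (X.chart (γ t) : EuclideanSpace ℝ (Fin 3))) r ≠ 0 := by
  have hs : ContDiffAt ℝ ∞ (fun t => (X.chart (γ t) : EuclideanSpace ℝ (Fin 3))) r :=
    ContDiffAt.comp (g := fun w => (X.chart w : EuclideanSpace ℝ (Fin 3))) r (X.smooth _ hr) hγ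
  refine ⟨hs, fun h0 => hk ?_⟩
  have h1 := (hs.differentiableAt (by simp)).hasDerivAt
  rw [h0] at h1
  have h2 : HasDerivAt (fun t => X.coord (X.chart (γ t))) 0 r := by
    refine (HasFDerivAt.comp_hasDerivAt (l := X.coord) r
      (X.differentiableAt_coord _ hr).hasFDerivAt h1).congr_deriv ?_
    exact map_zero _
  have h3 : HasDerivAt γ 0 r := by
    refine h2.congr_of_eventuallyEq ?_
    filter_upwards [hγ.continuousAt.eventually (X.chart.open_source.mem_nhds hr)] with t ht
    exact (X.coord_chart _ ht).symm
  have h4 : HasDerivAt (fun t => (γ t).1 - (γ t).2) 0 r := by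
    refine (HasFDerivAt.comp_hasDerivAt r
      (ContinuousLinearMap.fst ℝ ℝ ℝ - ContinuousLinearMap.snd ℝ ℝ ℝ).hasFDerivAt h3).congr_deriv ?_
    exact map_zero _
  have h5 : HasDerivAt (fun t => k * t + d) k r := by
    simpa using ((hasDerivAt_id r).const_mul k).add_const d
  exact h5.unique (h4.congr_of_eventuallyEq (Filter.Eventually.of_forall fun t => (hd t).symm))

theorem regular_inside {r : ℝ} (h : |‖(r : UnitAddCircle)‖ - ℓ| < X.ε) :
    ContDiffAt ℝ ∞ (fun t : ℝ => (X.spliceMap t : EuclideanSpace ℝ (Fin 3))) r ∧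
      deriv (fun t : ℝ => (X.spliceMap t : EuclideanSpace ℝ (Fin 3))) r ≠ 0 := by
  have hε := X.ε_pos
  obtain ⟨u, hu, -, hx⟩ := X.exists_coe_eq h.le
  have hu1 := X.abs_lt_one hu h
  have hcont : ∀ c : ℝ, ∀ᶠ t in nhds (c + X.ε * u), |(t - c) / X.ε| < 1 := by
    intro c
    have hc : Continuous fun t : ℝ => |(t - c) / X.ε| := by fun_prop
    refine hc.continuousAt.eventually_lt_const ?_
    beta_reduce
    rwa [add_sub_cancel_left, mul_div_cancel_left₀ _ hε.ne']
  have hsm : ∀ c : ℝ, ContDiff ℝ ∞ fun t : ℝ => corner ((t - c) / X.ε) := fun c =>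
    contDiff_corner.comp ((contDiff_id.sub contDiff_const).div_const _)
  have hval : ∀ c : ℝ, corner ((c + X.ε * u - c) / X.ε) ∈ openSquare := by
    intro c
    rw [add_sub_cancel_left, mul_div_cancel_left₀ _ hε.ne']
    exact corner_mem_openSquare hu1
  rcases hx with hx | hx
  · refine UnitAddCircle.contDiffAt_and_deriv_ne_zero_congr
      (F := fun x => (X.spliceMap x : EuclideanSpace ℝ (Fin 3))) hx ?_
    have heq : (fun t : ℝ => (X.spliceMap t : EuclideanSpace ℝ (Fin 3))) =ᶠ[nhds (ℓ + X.ε * u)]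
        fun t => X.chart (-corner ((t - ℓ) / X.ε)) := by
      filter_upwards [hcont ℓ] with t ht
      rw [← X.spliceMap_coe_add ht.le, mul_div_cancel₀ _ hε.ne', add_sub_cancel]
    have := X.regular_chart_comp (γ := fun t => -corner ((t - ℓ) / X.ε)) (r := ℓ + X.ε * u)
      (k := -X.ε⁻¹) (d := ℓ / X.ε) (hsm ℓ).neg.contDiffAt
      (X.mem_source (neg_mem_openSquare (hval ℓ))) (neg_ne_zero.2 (inv_ne_zero hε.ne')) (by
        intro t
        have := corner_fst_sub_snd ((t - ℓ) / X.ε)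
        rw [Prod.fst_neg, Prod.snd_neg, neg_sub_neg, ← neg_sub, this]
        ring)
    exact ⟨this.1.congr_of_eventuallyEq heq, by rw [heq.deriv_eq]; exact this.2⟩
  · refine UnitAddCircle.contDiffAt_and_deriv_ne_zero_congr
      (F := fun x => (X.spliceMap x : EuclideanSpace ℝ (Fin 3))) hx ?_
    have heq : (fun t : ℝ => (X.spliceMap t : EuclideanSpace ℝ (Fin 3))) =ᶠ[nhds (-ℓ + X.ε * u)]
        fun t => X.chart (corner ((t - -ℓ) / X.ε)) := by
      filter_upwards [hcont (-ℓ)] with t ht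
      rw [← X.spliceMap_coe_neg_add ht.le, mul_div_cancel₀ _ hε.ne', add_sub_cancel]
    have := X.regular_chart_comp (γ := fun t => corner ((t - -ℓ) / X.ε)) (r := -ℓ + X.ε * u)
      (k := X.ε⁻¹) (d := ℓ / X.ε) (hsm (-ℓ)).contDiffAt
      (X.mem_source (hval (-ℓ))) (inv_ne_zero hε.ne') (by
        intro t
        rw [corner_fst_sub_snd]
        ring)
    exact ⟨this.1.congr_of_eventuallyEq heq, by rw [heq.deriv_eq]; exact this.2⟩

/-- Locally the splice is `P` traversed forwards or backwards. The nonzero factor `s` carries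
immersion and transversality over from `P`. -/
theorem regular_outside {r : ℝ} (h : X.ε ≤ |‖(r : UnitAddCircle)‖ - ℓ|) :
    ContDiffAt ℝ ∞ (fun t : ℝ => (X.spliceMap t : EuclideanSpace ℝ (Fin 3))) r ∧
    ∃ r' s : ℝ, s ≠ 0 ∧ (r' : UnitAddCircle) = m + reverseArc ℓ r ∧
      deriv (fun t : ℝ => (X.spliceMap t : EuclideanSpace ℝ (Fin 3))) r =
        s • deriv (fun t : ℝ => (P.toFun t : EuclideanSpace ℝ (Fin 3))) r' := by
  have hε := X.ε_pos
  have hnorm : Continuous fun t : ℝ => ‖(t : UnitAddCircle)‖ :=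
    continuous_norm.comp (AddCircle.continuous_mk' 1)
  rcases le_abs'.1 h with h | h
  · have heq : (fun t : ℝ => (X.spliceMap t : EuclideanSpace ℝ (Fin 3))) =ᶠ[nhds r]
        fun t => P.toFun ((m + t : ℝ) : UnitAddCircle) := by
      filter_upwards [hnorm.continuousAt.eventually_lt_const
        (show ‖(r : UnitAddCircle)‖ < ℓ - X.ε / 2 by linarith)] with t ht
      rw [X.spliceMap_of_norm_le ht.le, AddCircle.coe_add]
    refine ⟨ContDiffAt.congr_of_eventuallyEq
      (P.smooth.comp (contDiff_const.add contDiff_id)).contDiffAt heq, m + r, 1, one_ne_zero, ?_, ?_⟩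
    · rw [reverseArc_of_le (by linarith), AddCircle.coe_add]
    · rw [heq.deriv_eq,
        deriv_comp_const_add (f := fun t : ℝ => (P.toFun t : EuclideanSpace ℝ (Fin 3))), one_smul]
  · have heq : (fun t : ℝ => (X.spliceMap t : EuclideanSpace ℝ (Fin 3))) =ᶠ[nhds r]
        fun t => P.toFun ((m - t : ℝ) : UnitAddCircle) := by
      filter_upwards [hnorm.continuousAt.eventually_const_lt
        (show ℓ + X.ε / 2 < ‖(r : UnitAddCircle)‖ by linarith)] with t ht
      rw [X.spliceMap_of_le_norm ht.le, AddCircle.coe_sub]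
    refine ⟨ContDiffAt.congr_of_eventuallyEq
      (P.smooth.comp (contDiff_const.sub contDiff_id)).contDiffAt heq, m - r, -1, by norm_num, ?_, ?_⟩
    · rw [reverseArc_of_lt (by linarith), AddCircle.coe_sub, sub_eq_add_neg]
    · rw [heq.deriv_eq,
        deriv_comp_const_sub (f := fun t : ℝ => (P.toFun t : EuclideanSpace ℝ (Fin 3))), neg_one_smul]

theorem spliceMap_mem_inside_iff {x : UnitAddCircle} :
    X.spliceMap x ∈ X.inside ↔ |‖x‖ - ℓ| < X.ε := by
  by_cases h : |‖x‖ - ℓ| < X.ε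
  · refine iff_of_true ?_ h
    obtain ⟨u, hu, hu1, hx⟩ := X.exists_coe_eq h.le
    have hc := corner_mem_openSquare (X.abs_lt_one hu h)
    rcases hx with rfl | rfl
    · rw [X.spliceMap_coe_add hu1]
      exact ⟨_, neg_mem_openSquare hc, rfl⟩
    · rw [X.spliceMap_coe_neg_add hu1]
      exact ⟨_, hc, rfl⟩
  · rw [X.spliceMap_of_le_abs (not_lt.1 h), X.mem_inside_iff, norm_reverseArc]

/-- The two corners are simple and disjoint, so smoothing creates no double point in the open disc.
-/
theorem eq_of_spliceMap_eq {x y : UnitAddCircle} (hx : |‖x‖ - ℓ| < X.ε)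
    (h : X.spliceMap x = X.spliceMap y) : x = y := by
  have hy := X.spliceMap_mem_inside_iff.1 (h ▸ X.spliceMap_mem_inside_iff.2 hx)
  obtain ⟨u, hu, hu1, hxu⟩ := X.exists_coe_eq hx.le
  obtain ⟨v, hv, hv1, hyv⟩ := X.exists_coe_eq hy.le
  have hcu := corner_mem_openSquare (X.abs_lt_one hu hx)
  have hcv := corner_mem_openSquare (X.abs_lt_one hv hy)
  have hcu' := X.mem_source (neg_mem_openSquare hcu)
  have hcv' := X.mem_source (neg_mem_openSquare hcv)
  replace hcu := X.mem_source hcu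
  replace hcv := X.mem_source hcv
  rcases hxu with rfl | rfl <;> rcases hyv with rfl | rfl <;>
    simp only [X.spliceMap_coe_add hu1, X.spliceMap_coe_add hv1, X.spliceMap_coe_neg_add hu1,
      X.spliceMap_coe_neg_add hv1] at h
  · rw [corner_injective (neg_injective (X.chart.injOn hcu' hcv' h))]
  · exact absurd (X.chart.injOn hcu' hcv h).symm (corner_ne_neg_corner v u)
  · exact absurd (X.chart.injOn hcu hcv' h) (corner_ne_neg_corner u v)
  · rw [corner_injective (X.chart.injOn hcu hcv h)]

theorem le_abs_of_spliceMap_eq {x y : UnitAddCircle} (hxy : x ≠ y)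
    (h : X.spliceMap x = X.spliceMap y) : X.ε ≤ |‖x‖ - ℓ| :=
  not_lt.1 fun hx => hxy (X.eq_of_spliceMap_eq hx h)

theorem toFun_eq_of_spliceMap_eq {x y : UnitAddCircle} (hxy : x ≠ y)
    (h : X.spliceMap x = X.spliceMap y) :
    P.toFun (m + reverseArc ℓ x) = P.toFun (m + reverseArc ℓ y) := by
  rwa [← X.spliceMap_of_le_abs (X.le_abs_of_spliceMap_eq hxy h),
    ← X.spliceMap_of_le_abs (X.le_abs_of_spliceMap_eq hxy.symm h.symm)]

theorem add_reverseArc_injective :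
    Function.Injective fun x : UnitAddCircle => (m : UnitAddCircle) + reverseArc ℓ x :=
  (add_right_injective _).comp (reverseArc_injective ℓ)

/-- The non-Seifert splice at a double point, provided that a double point remains. -/
noncomputable def splice (hd : ∃ s t : UnitAddCircle, s ≠ t ∧ X.spliceMap s = X.spliceMap t) :
    KnotProjection where
  toFun := X.spliceMap
  smooth := contDiff_iff_contDiffAt.2 fun r => by
    rcases lt_or_ge |‖(r : UnitAddCircle)‖ - ℓ| X.ε with h | h
    · exact (X.regular_inside h).1
    · exact (X.regular_outside h).1
  immersion r := by
    rcases lt_or_ge |‖(r : UnitAddCircle)‖ - ℓ| X.ε with h | h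
    · exact (X.regular_inside h).2
    · obtain ⟨-, r', s, hs, -, hd⟩ := X.regular_outside h
      rw [hd]
      exact smul_ne_zero hs (P.immersion r')
  -- Coincident parameters of the splice lie outside the open disc, and there the injective map `m +
  -- reverseArc ℓ x` takes them to coincident parameters of `P`.
  no_triple s t u hst htu := by
    by_contra! h
    rcases P.no_triple _ _ _ (X.toFun_eq_of_spliceMap_eq h.1 hst)
      (X.toFun_eq_of_spliceMap_eq h.2.1 htu) with h' | h' | h'
    · exact h.1 (add_reverseArc_injective h')
    · exact h.2.1 (add_reverseArc_injective h')
    · exact h.2.2 (add_reverseArc_injective h')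
  transverse r r' hne h := by
    obtain ⟨-, a, s, hs, ha, hda⟩ := X.regular_outside (X.le_abs_of_spliceMap_eq hne h)
    obtain ⟨-, b, t, ht, hb, hdb⟩ := X.regular_outside (X.le_abs_of_spliceMap_eq hne.symm h.symm)
    have hP := P.transverse a b (by rw [ha, hb]; exact fun h' => hne (add_reverseArc_injective h'))
      (by rw [ha, hb]; exact X.toFun_eq_of_spliceMap_eq hne h)
    rw [hda, hdb, LinearIndependent.pair_iff]
    intro x y hxy
    rw [smul_smul, smul_smul] at hxy
    obtain ⟨h1, h2⟩ := LinearIndependent.pair_iff.1 hP _ _ hxy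
    exact ⟨(mul_eq_zero.1 h1).resolve_right hs, (mul_eq_zero.1 h2).resolve_right ht⟩
  finite_double := by
    refine P.finite_double.subset ?_
    rintro p ⟨s, t, hst, rfl, ht⟩
    refine ⟨m + reverseArc ℓ s, m + reverseArc ℓ t, fun h => hst (add_reverseArc_injective h), ?_, ?_⟩
    · rw [X.spliceMap_of_le_abs (X.le_abs_of_spliceMap_eq hst ht.symm)]
    · rw [← ht, X.spliceMap_of_le_abs (X.le_abs_of_spliceMap_eq hst.symm ht)]
  exists_double := hd

end SmoothCrossing

/-! ### The construction is a non-Seifert splice -/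

theorem KnotProjection.isNonSeifertSplice_singleton {P Q : KnotProjection} {c : S2}
    (D : CrossingDisc P c)
    (h : {r : UnitAddCircle // P.toFun r ∉ D.inside} ≃ₜ {r : UnitAddCircle // Q.toFun r ∉ D.inside})
    (hh : ∀ r, Q.toFun (h r) = P.toFun r) (hs : D.IsNonSeifertSmoothing Q) :
    P.IsNonSeifertSplice Q {c} := by
  -- Treating `D` as a value of the family confines the transport along `p = c` to this line.
  obtain ⟨D', rfl⟩ : ∃ D' : (p : ({c} : Finset S2)) → CrossingDisc P p,
      D' ⟨c, Finset.mem_singleton_self c⟩ = D :=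
    ⟨fun p => (Finset.mem_singleton.1 p.2).symm ▸ D, rfl⟩
  have hU : ⋃ p, (D' p).inside = (D' ⟨c, Finset.mem_singleton_self c⟩).inside :=
    Set.ext fun x => ⟨fun hx => by
      obtain ⟨p, hp⟩ := Set.mem_iUnion.1 hx
      rwa [Subsingleton.elim p ⟨c, Finset.mem_singleton_self c⟩] at hp,
      fun hx => Set.mem_iUnion.2 ⟨_, hx⟩⟩
  refine ⟨D', fun p q hpq => absurd (Subsingleton.elim p q) hpq, ?_, ?_⟩
  · rw [hU]
    exact ⟨h, hh⟩
  · rintro ⟨p, hp⟩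
    obtain rfl := Finset.mem_singleton.1 hp
    exact hs

theorem corner_mem_closedSquare {u : ℝ} (hu : |u| ≤ 1) : corner u ∈ closedSquare := by
  by_cases h : |u| < 1
  · exact openSquare_subset_closedSquare (corner_mem_openSquare h)
  · rcases eq_or_eq_neg_of_abs_eq (le_antisymm hu (not_lt.1 h)) with rfl | rfl
    · rw [corner_of_le (by norm_num)]
      simp [closedSquare]
    · rw [corner_of_le_neg (by norm_num)]
      simp [closedSquare]

theorem neg_mem_closedSquare {z : ℝ × ℝ} (hz : z ∈ closedSquare) : -z ∈ closedSquare := by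
  obtain ⟨⟨h1, h2⟩, h3, h4⟩ := hz
  exact ⟨⟨neg_le_neg h2, neg_le.1 h1⟩, ⟨neg_le_neg h4, neg_le.1 h3⟩⟩

/-- The corner as a path between the two axes. -/
noncomputable def cornerPath : Path ((1, 0) : ℝ × ℝ) (0, 1) where
  toFun v := corner (1 - 2 * (v : ℝ))
  continuous_toFun := contDiff_corner.continuous.comp (by fun_prop)
  source' := by
    rw [Set.Icc.coe_zero, corner_of_le (by norm_num)]
    simp
  target' := by
    rw [Set.Icc.coe_one, corner_of_le_neg (by norm_num)]
    norm_num

theorem abs_one_sub_two_mul_le (v : unitInterval) : |1 - 2 * (v : ℝ)| ≤ 1 :=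
  abs_le.2 ⟨by linarith [v.2.2], by linarith [v.2.1]⟩

theorem exists_one_sub_two_mul_eq {u : ℝ} (hu : |u| ≤ 1) :
    ∃ v : unitInterval, 1 - 2 * (v : ℝ) = u := by
  rw [abs_le] at hu
  exact ⟨⟨(1 - u) / 2, by linarith, by linarith⟩, by simp; ring⟩

theorem cornerPath_injective : Function.Injective cornerPath := fun v w h => by
  have : 1 - 2 * (v : ℝ) = 1 - 2 * (w : ℝ) := corner_injective h
  exact Subtype.ext (by linarith)

theorem cornerPath_mem_openSquare {v : unitInterval} (h0 : v ≠ 0) (h1 : v ≠ 1) :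
    cornerPath v ∈ openSquare := by
  have h0' : 0 < (v : ℝ) := unitInterval.coe_pos.2 (unitInterval.pos_iff_ne_zero.2 h0)
  have h1' : (v : ℝ) < 1 := unitInterval.coe_lt_one.2 (unitInterval.lt_one_iff_ne_one.2 h1)
  exact corner_mem_openSquare (abs_lt.2 ⟨by linarith, by linarith⟩)

namespace SmoothCrossing

variable {P : KnotProjection} {m ℓ : ℝ} (X : SmoothCrossing P m ℓ)

theorem abs_norm_sub_le_of_spliceMap_mem {x : UnitAddCircle} (h : X.spliceMap x ∈ X.carrier) :
    |‖x‖ - ℓ| ≤ X.ε := by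
  by_contra! hx
  rw [X.spliceMap_of_le_abs hx.le] at h
  have := X.abs_norm_sub_le_of_mem_carrier h
  rw [norm_reverseArc] at this
  exact hx.not_ge this

theorem isNonSeifertSmoothing
    (hd : ∃ s t : UnitAddCircle, s ≠ t ∧ X.spliceMap s = X.spliceMap t) :
    X.toCrossingDisc.IsNonSeifertSmoothing (X.splice hd) := by
  -- The negated corner joins the incoming ends, the corner itself the outgoing ones.
  refine ⟨(cornerPath.map continuous_neg).cast (by simp) (by simp), cornerPath,
    neg_injective.comp cornerPath_injective, cornerPath_injective, ?_, ?_, ?_⟩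
  · rw [Set.disjoint_left]
    rintro - ⟨v, rfl⟩ ⟨w, hw⟩
    exact corner_ne_neg_corner _ _ hw
  · intro v h0 h1
    have := cornerPath_mem_openSquare h0 h1
    exact ⟨neg_mem_openSquare this, this⟩
  · ext p
    constructor
    · rintro ⟨⟨x, rfl⟩, hx⟩
      obtain ⟨u, -, hu, hxu⟩ := X.exists_coe_eq (X.abs_norm_sub_le_of_spliceMap_mem hx)
      obtain ⟨v, rfl⟩ := exists_one_sub_two_mul_eq hu
      rcases hxu with rfl | rfl
      · exact ⟨_, Or.inl ⟨v, rfl⟩, (X.spliceMap_coe_add hu).symm⟩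
      · exact ⟨_, Or.inr ⟨v, rfl⟩, (X.spliceMap_coe_neg_add hu).symm⟩
    · rintro ⟨-, ⟨v, rfl⟩ | ⟨v, rfl⟩, rfl⟩
      · exact ⟨⟨_, X.spliceMap_coe_add (abs_one_sub_two_mul_le v)⟩,
          ⟨_, neg_mem_closedSquare (corner_mem_closedSquare (abs_one_sub_two_mul_le v)), rfl⟩⟩
      · exact ⟨⟨_, X.spliceMap_coe_neg_add (abs_one_sub_two_mul_le v)⟩,
          ⟨_, corner_mem_closedSquare (abs_one_sub_two_mul_le v), rfl⟩⟩

theorem norm_ne_of_le_abs {x : UnitAddCircle} (hx : X.ε ≤ |‖x‖ - ℓ|) : ‖x‖ ≠ ℓ := fun h => by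
  rw [h, sub_self, abs_zero] at hx
  exact hx.not_gt X.ε_pos

theorem le_abs_of_notMem_inside {x : UnitAddCircle} (hx : P.toFun x ∉ X.inside) :
    X.ε ≤ |‖x - m‖ - ℓ| :=
  not_lt.1 fun h => hx (by simpa using X.mem_inside_iff.2 h)

/-- The change of parameter outside the disc. -/
noncomputable def outsideHomeomorph :
    {r : UnitAddCircle // P.toFun r ∉ X.inside} ≃ₜ
      {r : UnitAddCircle // X.spliceMap r ∉ X.inside} where
  toFun x := ⟨reverseArc ℓ (x - m), by
    rw [X.spliceMap_mem_inside_iff, norm_reverseArc]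
    exact (X.le_abs_of_notMem_inside x.2).not_gt⟩
  invFun y := ⟨m + reverseArc ℓ y, by
    rw [X.mem_inside_iff, norm_reverseArc, ← X.spliceMap_mem_inside_iff]
    exact y.2⟩
  left_inv x := Subtype.ext (by simp [reverseArc_reverseArc])
  right_inv y := Subtype.ext (by simp [reverseArc_reverseArc])
  continuous_toFun := by
    refine Continuous.subtype_mk (continuous_iff_continuousAt.2 fun x => ?_) _
    exact ContinuousAt.comp (g := reverseArc ℓ)
      (continuousAt_reverseArc (X.norm_ne_of_le_abs (X.le_abs_of_notMem_inside x.2)))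
      (continuous_subtype_val.sub continuous_const).continuousAt
  continuous_invFun := by
    refine Continuous.subtype_mk (continuous_iff_continuousAt.2 fun y => ?_) _
    exact continuousAt_const.add (ContinuousAt.comp (g := reverseArc ℓ)
      (continuousAt_reverseArc (X.norm_ne_of_le_abs
        (not_lt.1 fun h => y.2 (X.spliceMap_mem_inside_iff.2 h))))
      continuous_subtype_val.continuousAt)

theorem isNonSeifertSplice_splice
    (hd : ∃ s t : UnitAddCircle, s ≠ t ∧ X.spliceMap s = X.spliceMap t) :
    P.IsNonSeifertSplice (X.splice hd) {P.toFun ((m - ℓ : ℝ) : UnitAddCircle)} := by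
  refine KnotProjection.isNonSeifertSplice_singleton X.toCrossingDisc X.outsideHomeomorph
    (fun x => ?_) (X.isNonSeifertSmoothing hd)
  change X.spliceMap (reverseArc ℓ (x - m)) = P.toFun x
  rw [X.spliceMap_of_le_abs, reverseArc_reverseArc, add_sub_cancel]
  rw [norm_reverseArc]
  exact X.le_abs_of_notMem_inside x.2

end SmoothCrossing

/-! ### Chords before and after the splice -/

namespace KnotProjection

theorem hasSubdiagram_H_of_crossing {P : KnotProjection} {p : ℝ → S2} {m : ℝ}
    (hp : ∀ r : ℝ, p r = P.toFun ((m + r : ℝ) : UnitAddCircle)) {a b c d e f : ℝ} (hab : a < b)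
    (hbc : b < c) (hcd : c < d) (hde : d < e) (hef : e < f) (hfa : f < a + 1) (hac : p a = p c)
    (hbe : p b = p e) (hdf : p d = p f) : P.chordDiagram.HasSubdiagram ChordDiagram.H := by
  simp only [hp] at hac hbe hdf
  exact P.hasSubdiagram_H' (add_lt_add_right hab m) (add_lt_add_right hbc m)
    (add_lt_add_right hcd m) (add_lt_add_right hde m) (add_lt_add_right hef m) (by linarith)
    hac hbe hdf

/-- If two crossing chords are not part of an H, then splicing at one of them makes the other double
point nugatory. -/
theorem exists_splice_reducible_or_H (P : KnotProjection) {m ℓ a b : ℝ} (hℓ0 : 0 < ℓ)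
    (hℓ1 : ℓ < 1 / 2) (hc : P.toFun ((m - ℓ : ℝ) : UnitAddCircle) = P.toFun ((m + ℓ : ℝ) : UnitAddCircle))
    (ha1 : -ℓ < a) (ha2 : a < ℓ) (hb1 : ℓ < b) (hb2 : b < 1 - ℓ)
    (hab : P.toFun ((m + a : ℝ) : UnitAddCircle) = P.toFun ((m + b : ℝ) : UnitAddCircle)) :
    (∃ Q, P.IsNonSeifertSplice Q {P.toFun ((m - ℓ : ℝ) : UnitAddCircle)} ∧ Q.Reducible) ∨
      P.chordDiagram.HasSubdiagram ChordDiagram.H := by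
  obtain ⟨X⟩ := P.nonempty_smoothCrossing hℓ0 hℓ1 hc
  by_cases hH : P.chordDiagram.HasSubdiagram ChordDiagram.H
  · exact Or.inr hH
  have hna : ‖(a : UnitAddCircle)‖ < ℓ := by
    have h : |a| < ℓ := abs_lt.2 ⟨ha1, ha2⟩
    rwa [UnitAddCircle.norm_coe_of_abs_le (h.trans hℓ1).le]
  have hab' : P.toFun (m + (a : UnitAddCircle)) = P.toFun (m + (b : UnitAddCircle)) := by
    simpa only [AddCircle.coe_add] using hab
  -- The only double point in the open disc is its centre, with parameters of norm `ℓ`; so the chord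
  -- from `a` to `b` survives the splice.
  have hoa : X.ε ≤ |‖(a : UnitAddCircle)‖ - ℓ| := not_lt.1 fun h => hna.ne
    (X.norm_eq_of_toFun_eq (UnitAddCircle.coe_ne_coe (ha2.trans hb1) (by linarith)) hab' h)
  have hob : X.ε ≤ |‖(b : UnitAddCircle)‖ - ℓ| := by
    rw [← not_lt, ← X.mem_inside_iff, ← hab', X.mem_inside_iff, not_lt]
    exact hoa
  have hnb : ℓ < ‖(b : UnitAddCircle)‖ :=
    lt_of_le_of_ne (UnitAddCircle.le_norm_coe hℓ0.le hb1.le hb2.le) (X.norm_ne_of_le_abs hob).symm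
  have hQa : X.spliceMap (a : UnitAddCircle) = P.toFun (m + a) := by
    rw [X.spliceMap_of_le_abs hoa, reverseArc_of_le hna.le]
  have coe_one_sub : ∀ r : ℝ, ((1 - r : ℝ) : UnitAddCircle) = -r := fun r => by
    rw [sub_eq_neg_add, UnitAddCircle.coe_add_one, AddCircle.coe_neg]
  -- The reversal takes `b` to `-b`, whose representative between `a` and `a + 1` is `1 - b`.
  have hQb : X.spliceMap ((1 - b : ℝ) : UnitAddCircle) = P.toFun (m + b) := by
    rw [coe_one_sub, X.spliceMap_of_le_abs (by rwa [norm_neg]),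
      reverseArc_of_lt (by rwa [norm_neg]), neg_neg]
  have hQab : X.spliceMap a = X.spliceMap ((1 - b : ℝ) : UnitAddCircle) := by
    rw [hQa, hQb, hab']
  have hd : ∃ s t : UnitAddCircle, s ≠ t ∧ X.spliceMap s = X.spliceMap t :=
    ⟨_, _, UnitAddCircle.coe_ne_coe (by linarith) (by linarith), hQab⟩
  refine Or.inl ⟨X.splice hd, X.isNonSeifertSplice_splice hd,
    (X.splice hd).reducible_of_uncrossed (x := a) (y := 1 - b) (by linarith) (by linarith) hQab ?_⟩
  -- A chord of the splice that crosses the one from `a` to `1 - b` is pulled back to `P`: each end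
  -- is kept or reversed, according to its distance from zero.
  rintro u ⟨hu1, hu2⟩ v ⟨hv1, hv2⟩ (huv : X.spliceMap u = X.spliceMap v)
  have hne : (u : UnitAddCircle) ≠ v := UnitAddCircle.coe_ne_coe (hu2.trans hv1) (by linarith)
  have hPuv := X.toFun_eq_of_spliceMap_eq hne huv
  have hnu := X.norm_ne_of_le_abs (X.le_abs_of_spliceMap_eq hne huv)
  have hnv := X.norm_ne_of_le_abs (X.le_abs_of_spliceMap_eq hne.symm huv.symm)
  obtain ⟨u', hu', hu''⟩ : ∃ u' : ℝ, reverseArc ℓ u = u' ∧ (a < u' ∧ u' < ℓ ∨ b < u' ∧ u' < 1 - ℓ) := by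
    rcases hnu.lt_or_gt with h | h
    · refine ⟨u, reverseArc_of_le h.le, Or.inl ⟨hu1, ?_⟩⟩
      by_contra! h'
      exact h.not_ge (UnitAddCircle.le_norm_coe hℓ0.le h' (by linarith))
    · refine ⟨1 - u, by rw [reverseArc_of_lt h, coe_one_sub], Or.inr ⟨by linarith, ?_⟩⟩
      by_contra! h'
      have h2 : |u| ≤ ℓ := abs_le.2 ⟨by linarith, by linarith⟩
      rw [UnitAddCircle.norm_coe_of_abs_le (by linarith)] at h
      exact h.not_ge h2
  obtain ⟨v', hv', hv''⟩ : ∃ v' : ℝ, reverseArc ℓ v = v' ∧ (-ℓ < v' ∧ v' < a ∨ ℓ < v' ∧ v' < b) := by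
    rcases hnv.lt_or_gt with h | h
    · refine ⟨v - 1, ?_, Or.inl ⟨?_, by linarith⟩⟩
      · rw [reverseArc_of_le h.le, ← UnitAddCircle.coe_add_one (v - 1), sub_add_cancel]
      · by_contra! h'
        exact h.not_ge (UnitAddCircle.le_norm_coe hℓ0.le (by linarith) (by linarith))
    · refine ⟨1 - v, by rw [reverseArc_of_lt h, coe_one_sub], Or.inr ⟨?_, by linarith⟩⟩
      by_contra! h'
      have h2 : |v - 1| ≤ ℓ := abs_le.2 ⟨by linarith, by linarith⟩
      rw [← sub_add_cancel v 1, UnitAddCircle.coe_add_one,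
        UnitAddCircle.norm_coe_of_abs_le (by linarith)] at h
      exact h.not_ge h2
  refine hH ?_
  set p : ℝ → S2 := fun r => P.toFun ((m + r : ℝ) : UnitAddCircle)
  have hp : ∀ r, p r = P.toFun ((m + r : ℝ) : UnitAddCircle) := fun _ => rfl
  have h1 : ∀ r, p (r + 1) = p r := fun r => by
    rw [hp, hp, ← add_assoc, UnitAddCircle.coe_add_one]
  have hpuv : p u' = p v' := by
    rw [hp, hp, AddCircle.coe_add, AddCircle.coe_add, ← hu', ← hv', hPuv]
  have hpab : p a = p b := hab
  have hpℓ : p (1 - ℓ) = p ℓ := by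
    rw [sub_eq_neg_add, h1]
    exact hc
  -- If `u'` and `v'` lie on the same side of the spliced chord (first and last case), the bar of
  -- the H is the chord from `a` to `b`. Otherwise it is the spliced chord itself. Shifts by 1 put
  -- the six ends into one period.
  rcases hu'' with ⟨hu3, hu4⟩ | ⟨hu3, hu4⟩ <;> rcases hv'' with ⟨hv3, hv4⟩ | ⟨hv3, hv4⟩
  · exact hasSubdiagram_H_of_crossing hp (a := v') (b := a) (c := u') (d := ℓ) (e := b) (f := 1 - ℓ)
      hv4 hu3 hu4 hb1 hb2 (by linarith) hpuv.symm hpab hpℓ.symm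
  · exact hasSubdiagram_H_of_crossing hp (a := u') (b := ℓ) (c := v') (d := b) (e := 1 - ℓ)
      (f := a + 1) hu4 hv3 hv4 hb2 (by linarith) (by linarith) hpuv hpℓ.symm
      (by rw [h1, hpab])
  · exact hasSubdiagram_H_of_crossing hp (a := u') (b := 1 - ℓ) (c := v' + 1) (d := a + 1)
      (e := ℓ + 1) (f := b + 1) hu4 (by linarith) (by linarith) (by linarith) (by linarith)
      (by linarith) (by rw [h1, hpuv]) (by rw [h1, hpℓ]) (by rw [h1, h1, hpab])
  · exact hasSubdiagram_H_of_crossing hp (a := v') (b := b) (c := u') (d := 1 - ℓ) (e := a + 1)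
      (f := ℓ + 1) hv4 hu3 hu4 (by linarith) (by linarith) (by linarith) hpuv.symm
      (by rw [h1, hpab]) (by rw [h1, hpℓ])

end KnotProjection

theorem mainTheorem11 (P : KnotProjection) (hP : P.y = 2) :
    P.chordDiagram.HasSubdiagram ChordDiagram.H := by
  -- The hypothesis enters as this bound, applied below to no splice and to a single one.
  have hle : ∀ (S : Finset S2) (Q : KnotProjection), P.IsNonSeifertSplice Q S → Q.Reducible →
      2 ≤ S.card := by
    intro S Q hQ hr
    have : P.y ≤ S.card := sInf_le ⟨S, Q, hQ, hr, rfl⟩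
    rw [hP] at this
    exact_mod_cast this
  obtain ⟨s', t', hne, h⟩ := P.exists_double
  obtain ⟨s, -, -, rfl⟩ := UnitAddCircle.exists_coe_eq 0 s'
  obtain ⟨t, hst, hts, rfl⟩ := UnitAddCircle.exists_coe_eq s t'
  replace hst : s < t := lt_of_le_of_ne hst fun h => hne (h ▸ rfl)
  -- Centred at the midpoint `m` of the preimages, reversing an arc becomes negation of the
  -- parameter.
  obtain ⟨m, ℓ, rfl, rfl⟩ : ∃ m ℓ : ℝ, m - ℓ = s ∧ m + ℓ = t :=
    ⟨(s + t) / 2, (t - s) / 2, by ring, by ring⟩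
  have hnot : ¬P.Reducible := fun hr => by
    simpa using hle ∅ P P.isNonSeifertSplice_empty hr
  have hcross : ∃ u ∈ Set.Ioo (m - ℓ) (m + ℓ), ∃ v ∈ Set.Ioo (m + ℓ) (m - ℓ + 1),
      P.toFun u = P.toFun v := by
    by_contra! hcon
    exact hnot (P.reducible_of_uncrossed hst hts h hcon)
  obtain ⟨u, ⟨hu1, hu2⟩, v, ⟨hv1, hv2⟩, huv⟩ := hcross
  rcases P.exists_splice_reducible_or_H (m := m) (ℓ := ℓ) (a := u - m) (b := v - m) (by linarith)
    (by linarith) h (by linarith) (by linarith) (by linarith) (by linarith)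
    (by simpa only [add_sub_cancel] using huv) with ⟨Q, hQ, hr⟩ | hH
  · simpa using hle _ Q hQ hr
  · exact hH
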